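/- Let $d\ge 1$ be an integer, $\alpha>d$, $\delta=d/\alpha\in(0,1)$, $P>0$, $N\ge 0$, $u>0$, $\tau>0$, and assume $\tau N<Pu^{-\alpha}$ (the signal to noise ratio $Pu^{-\alpha}/N$ exceeds $\tau$). For $\lambda\ge 0$ let $\Pi_{d,\lambda}$ be a homogeneous Poisson point process on $\mathbb{R}^d$ of intensity $\lambda$ (empty if $\lambda=0$), and let $$q(\lambda)=\mathbb{P}\left(\frac{P u^{-\alpha}}{\sum_{x\in\Pi_{d,\lambda}}P|x|^{-\alpha}+N}<\tau\right)$$ be the outage probability (OP) of the reference receiver at the origin, without guard zone ($\epsilon=0$), where $Pu^{-\alpha}/0=\infty$. Let $c_d$ be the volume of the unit ball of $\mathbb{R}^d$. Then $q$ is a bijection of $[0,\infty)$ onto $[q(0),1)$, so that the transmission capacity (TC) $\lambda(q^*)=q^{-1}(q^*)\,(1-q^*)$ is well defined for $q^*\in[q(0),1)$. The OP satisfies $$q(\lambda)=\frac{c_d\,\lambda}{\left(\frac{u^{-\alpha}}{\tau}-\frac{N}{P}\right)^{\delta}}+O(\lambda^2),\qquad \lambda\to 0$$ (in particular $q(0)=0$),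 and the TC satisfies $$\lambda(q^*)=\frac{1}{c_d}\left(\frac{u^{-\alpha}}{\tau}-\frac{N}{P}\right)^{\delta}q^*+O\left((q^*)^2\right),\qquad q^*\to 0.$$ -/

import Mathlib

open Set Filter Topology MeasureTheory ProbabilityTheory Asymptotics
open scoped NNReal ENNReal Nat

noncomputable section

/-- `X` is a homogeneous Poisson point process on `ℝ^d` of intensity `l` (for `l = 0` this is the
almost surely empty process): a random countable set of points whose numbers of points in
pairwise disjoint Borel sets are independent, the number of points in a bounded Borel set `A`
being Poisson with parameter `l * |A|`. -/
structure IsPoissonPointProcess {d : ℕ} {Ω : Type*} [MeasurableSpace Ω] (μ : Measure Ω)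
    (l : ℝ≥0) (X : Ω → Set (EuclideanSpace ℝ (Fin d))) : Prop where
  ae_countable : ∀ᵐ ω ∂μ, (X ω).Countable
  measurable_count : ∀ A : Set (EuclideanSpace ℝ (Fin d)), MeasurableSet A →
    Measurable fun ω => (X ω ∩ A).encard
  indep : ∀ (n : ℕ) (A : Fin n → Set (EuclideanSpace ℝ (Fin d))),
    (∀ i, MeasurableSet (A i)) → Pairwise (fun i j => Disjoint (A i) (A j)) →
    iIndepFun (fun i ω => (X ω ∩ A i).encard) μ
  poisson : ∀ A : Set (EuclideanSpace ℝ (Fin d)), MeasurableSet A → Bornology.IsBounded A →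
    ∀ k : ℕ, μ.real {ω | (X ω ∩ A).encard = k} =
      Real.exp (-(l * volume.real A)) * (l * volume.real A) ^ k / (k !)

/-- The truncated power law `r ↦ r ^ (-α) * 1_{r ≥ ε}`, with value `∞` at `r = 0` if `ε = 0`. -/
def pathLoss (α ε r : ℝ) : ℝ≥0∞ :=
  if ε ≤ r then ENNReal.ofReal r ^ (-α) else 0

/-- The aggregate interference power at the origin from interferers located at the points
of `X`. -/
def interference {d : ℕ} (α ε P : ℝ) (X : Set (EuclideanSpace ℝ (Fin d))) : ℝ≥0∞ :=
  ∑' x : X, ENNReal.ofReal P * pathLoss α ε ‖(x : EuclideanSpace ℝ (Fin d))‖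

/-- The signal to interference plus noise ratio at the origin. It is `∞` without interference
and noise, and `0` if the interference is infinite. -/
def sinr {d : ℕ} (α ε P N u : ℝ) (X : Set (EuclideanSpace ℝ (Fin d))) : ℝ≥0∞ :=
  (ENNReal.ofReal P * pathLoss α ε u) / (interference α ε P X + ENNReal.ofReal N)

/-- The outage probability at SINR threshold `τ` when the random set of interferers is `X`. -/
def outageProbability {d : ℕ} {Ω : Type*} [MeasurableSpace Ω] (μ : Measure Ω)
    (X : Ω → Set (EuclideanSpace ℝ (Fin d))) (α ε P N u τ : ℝ) : ℝ :=
  μ.real {ω | sinr α ε P N u (X ω) < ENNReal.ofReal τ}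

/-- The transmission capacity `q⁻¹(x) (1 - x)` at the outage constraint `x`, where `q` is the
outage probability as a function of the intensity; meaningful for `x` in the range of an
injective `q`. -/
def transmissionCapacity (q : ℝ≥0 → ℝ) (x : ℝ) : ℝ :=
  (Function.invFun q x : ℝ≥0) * (1 - x)

/-- The volume `c_d` of the unit ball of `ℝ^d`. -/
def unitBallVolume (d : ℕ) : ℝ :=
  volume.real (Metric.closedBall (0 : EuclideanSpace ℝ (Fin d)) 1)

end

/-! ### Point measures and counts -/

/-! Put `δ = d/α` and `b = u^(-α)/τ - N/P > 0`. Outage means that the shot noise `S`, the sum of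
`|x|^(-α)` over the points, exceeds `b`. A single point in the ball of radius `b^(-1/α)` suffices,
and there is one with probability `1 - exp(-C l)`, `C = c_d / b^δ`. Otherwise every summand is at
most `b`, and `S > b` takes several points. A first moment bound would only give `O(l)`. Instead,
the sum of a pair interaction over pairs of distinct points is then at least `1`
(`one_le_lintegral_pairInteraction`); by Markov's inequality and the second moment measure this has
probability at most `K l^2`. The double integral `K` is finite
(`lintegral_pairInteraction_powerLaw_ne_top`): its singularity is a power `-δ > -1` of `b -
|x|^(-α)`, and `|x|^(-α)` is integrable at infinity since `α > d`. So `1 - exp(-C l) ≤ q l ≤ 1 -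
exp(-C l) + K l^2`, and both expansions follow by calculus.

Bijectivity needs no formula for the law `ν l` of `S`. Superposition and dilation, both from
`map_shotNoise_eq_conv`, make `ν` a convolution semigroup in which `ν (c^δ l)` is `ν l` dilated by
`c`. The processes for different `l` may live on unrelated spaces: only laws enter. With the two
bounds this suffices (`IsStableSemigroup`): `ν 1` has no atoms, so `q` is continuous; `ν l [0, b] >
0`, so `q < 1`; submultiplicativity of `ν l [0, b]` makes `q` strictly increasing; the lower bound
tends to `1`, so the intermediate value theorem gives surjectivity. -/

/-- The counting measure of a set of points. -/
noncomputable def pointMeasure {E : Type*} [MeasurableSpace E] (X : Set E) : Measure E :=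
  Measure.sum fun x : X => Measure.dirac (x : E)

theorem pointMeasure_apply {E : Type*} [MeasurableSpace E] (X : Set E) {A : Set E}
    (hA : MeasurableSet A) : pointMeasure X A = ((X ∩ A).encard : ℝ≥0∞) := by
  rw [pointMeasure, Measure.sum_apply _ hA, ← Subtype.image_preimage_coe,
    Subtype.val_injective.encard_image, ← ENNReal.tsum_set_one,
    tsum_subtype (Subtype.val ⁻¹' A) fun _ : X => (1 : ℝ≥0∞)]
  refine tsum_congr fun x => ?_
  rw [Measure.dirac_apply' _ hA]
  rfl

theorem lintegral_pointMeasure {E : Type*} [MeasurableSpace E] (X : Set E) {g : E → ℝ≥0∞}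
    (hg : Measurable g) : ∫⁻ x, g x ∂pointMeasure X = ∑' x : X, g x := by
  rw [pointMeasure, lintegral_sum_measure]
  exact tsum_congr fun x => lintegral_dirac' _ hg

theorem pointMeasure_restrict {E : Type*} [MeasurableSpace E] (X : Set E) {B : Set E}
    (hB : MeasurableSet B) : (pointMeasure X).restrict B = pointMeasure (X ∩ B) := by
  ext A hA
  rw [Measure.restrict_apply hA, pointMeasure_apply _ hA, pointMeasure_apply _ (hA.inter hB),
    inter_assoc, inter_comm A B]

/-! ### Sums of weighted independent Poisson variables -/

/-- The masses on `ℕ` already add up to one, so nothing is left for `∞`. An inequality between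
probability measures is an equality. -/
theorem eq_map_natCast_poissonMeasure {ρ : Measure ℕ∞} [IsProbabilityMeasure ρ] {r : ℝ≥0}
    (h : ∀ k : ℕ, ρ {(k : ℕ∞)} = poissonMeasure r {k}) :
    ρ = (poissonMeasure r).map ((↑) : ℕ → ℕ∞) := by
  symm
  have : IsProbabilityMeasure ((poissonMeasure r).map ((↑) : ℕ → ℕ∞)) :=
    Measure.isProbabilityMeasure_map .of_discrete
  refine Measure.eq_of_le_of_isProbabilityMeasure (Measure.le_iff.2 fun s hs => ?_)
  rw [Measure.map_apply .of_discrete hs]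
  have h1 : poissonMeasure r ((↑) ⁻¹' s : Set ℕ) = ρ (((↑) : ℕ → ℕ∞) '' ((↑) ⁻¹' s)) := by
    rw [← biUnion_of_singleton ((↑) ⁻¹' s : Set ℕ), image_iUnion₂,
      measure_biUnion (to_countable _) (fun i _ j _ hij => by simpa using hij)
        (fun _ _ => .of_discrete),
      measure_biUnion (to_countable _) (fun i _ j _ hij => by simpa using hij)
        (fun _ _ => .of_discrete)]
    refine tsum_congr fun k => ?_
    rw [image_singleton, h]
  rw [h1]
  exact measure_mono (image_preimage_subset _ _)

theorem map_weighted_sum_insert {ι Ω : Type*} [DecidableEq ι] [MeasurableSpace Ω] {μ : Measure Ω}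
    [IsProbabilityMeasure μ] {Y : ι → Ω → ℝ≥0∞} (hY : iIndepFun Y μ) (hm : ∀ i, Measurable (Y i))
    (c : ι → ℝ≥0∞) {i : ι} {s : Finset ι} (hi : i ∉ s) :
    μ.map (∑ j ∈ insert i s, fun ω => c j * Y j ω) =
      (μ.map (Y i)).map (c i * ·) ∗ μ.map (∑ j ∈ s, fun ω => c j * Y j ω) := by
  have hm' : ∀ j, Measurable fun ω => c j * Y j ω := fun j => (hm j).const_mul _
  have hc : iIndepFun (fun j ω => c j * Y j ω) μ :=
    hY.comp (fun j x => c j * x) fun j => measurable_const_mul _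
  have hs : Measurable (∑ j ∈ s, fun ω => c j * Y j ω) := by
    rw [show (∑ j ∈ s, fun ω => c j * Y j ω) = fun ω => ∑ j ∈ s, c j * Y j ω by
      ext ω; simp]
    exact Finset.measurable_sum s fun j _ => hm' j
  rw [Finset.sum_insert hi, IndepFun.map_add_eq_map_conv_map (hm' i) hs
    (hc.indepFun_finsetSum_of_notMem hm' hi).symm, Measure.map_map (measurable_const_mul _) (hm i)]
  rfl

theorem map_zero_eq_dirac {Ω : Type*} [MeasurableSpace Ω] (μ : Measure Ω)
    [IsProbabilityMeasure μ] : μ.map (0 : Ω → ℝ≥0∞) = Measure.dirac 0 := by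
  have := Measure.map_const μ (0 : ℝ≥0∞)
  rwa [measure_univ, one_smul] at this

theorem conv_conv_conv_comm {M : Type*} [AddCommMonoid M] [MeasurableSpace M] [MeasurableAdd₂ M]
    (p q r s : Measure M) [SFinite p] [SFinite q] [SFinite r] [SFinite s] :
    (p ∗ q) ∗ (r ∗ s) = (p ∗ r) ∗ (q ∗ s) := by
  rw [Measure.conv_assoc p q, Measure.conv_assoc p r, ← Measure.conv_assoc q r,
    ← Measure.conv_assoc r q, Measure.conv_comm q r]

/-- Independence turns sums into convolutions, Poisson laws convolve by adding parameters, and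
dilation by `c i` respects convolution. Commutativity regroups the factors. -/
theorem map_weighted_poisson_sum {ι Ω₀ Ω₁ Ω₂ : Type*} [MeasurableSpace Ω₀] [MeasurableSpace Ω₁]
    [MeasurableSpace Ω₂] {μ₀ : Measure Ω₀} {μ₁ : Measure Ω₁} {μ₂ : Measure Ω₂}
    [IsProbabilityMeasure μ₀] [IsProbabilityMeasure μ₁] [IsProbabilityMeasure μ₂]
    {Y₀ : ι → Ω₀ → ℝ≥0∞} {Y₁ : ι → Ω₁ → ℝ≥0∞} {Y₂ : ι → Ω₂ → ℝ≥0∞} {r₁ r₂ : ι → ℝ≥0}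
    (h₀ : iIndepFun Y₀ μ₀) (h₁ : iIndepFun Y₁ μ₁) (h₂ : iIndepFun Y₂ μ₂)
    (m₀ : ∀ i, Measurable (Y₀ i)) (m₁ : ∀ i, Measurable (Y₁ i)) (m₂ : ∀ i, Measurable (Y₂ i))
    (l₀ : ∀ i, μ₀.map (Y₀ i) = (poissonMeasure (r₁ i + r₂ i)).map ((↑) : ℕ → ℝ≥0∞))
    (l₁ : ∀ i, μ₁.map (Y₁ i) = (poissonMeasure (r₁ i)).map ((↑) : ℕ → ℝ≥0∞))
    (l₂ : ∀ i, μ₂.map (Y₂ i) = (poissonMeasure (r₂ i)).map ((↑) : ℕ → ℝ≥0∞))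
    (c : ι → ℝ≥0∞) (s : Finset ι) :
    μ₀.map (∑ i ∈ s, fun ω => c i * Y₀ i ω) =
      μ₁.map (∑ i ∈ s, fun ω => c i * Y₁ i ω) ∗ μ₂.map (∑ i ∈ s, fun ω => c i * Y₂ i ω) := by
  classical
  induction s using Finset.induction_on with
  | empty =>
    simp only [Finset.sum_empty, map_zero_eq_dirac, Measure.conv_dirac_zero]
  | insert i s hi ih =>
    have hc : ∀ r r' : ℝ≥0, ((poissonMeasure (r + r')).map ((↑) : ℕ → ℝ≥0∞)).map (c i * ·) =
        ((poissonMeasure r).map ((↑) : ℕ → ℝ≥0∞)).map (c i * ·) ∗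
          ((poissonMeasure r').map ((↑) : ℕ → ℝ≥0∞)).map (c i * ·) := fun r r' => by
      rw [← map_cast_poissonMeasure_conv]
      exact Measure.map_conv_addMonoidHom (AddMonoidHom.mulLeft (c i)) (measurable_const_mul _)
    rw [map_weighted_sum_insert h₀ m₀ c hi, map_weighted_sum_insert h₁ m₁ c hi,
      map_weighted_sum_insert h₂ m₂ c hi, ih, l₀, l₁, l₂, hc]
    exact conv_conv_conv_comm _ _ _ _

/-! ### Poisson point processes -/

section PoissonProcess

variable {d : ℕ} {Ω : Type*} [MeasurableSpace Ω] {μ : Measure Ω} {l : ℝ≥0}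
  {X : Ω → Set (EuclideanSpace ℝ (Fin d))}

theorem IsPoissonPointProcess.measurable_pointMeasure (hX : IsPoissonPointProcess μ l X) :
    Measurable fun ω => pointMeasure (X ω) := by
  refine Measure.measurable_of_measurable_coe _ fun A hA => ?_
  simp only [pointMeasure_apply _ hA]
  exact (Measurable.of_discrete (f := ((↑) : ℕ∞ → ℝ≥0∞))).comp (hX.measurable_count A hA)

theorem IsPoissonPointProcess.map_count [IsProbabilityMeasure μ]
    (hX : IsPoissonPointProcess μ l X) {A : Set (EuclideanSpace ℝ (Fin d))}
    (hA : MeasurableSet A) (hb : Bornology.IsBounded A) :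
    μ.map (fun ω => pointMeasure (X ω) A) =
      (poissonMeasure (l * (volume A).toNNReal)).map ((↑) : ℕ → ℝ≥0∞) := by
  have hm := hX.measurable_count A hA
  have : IsProbabilityMeasure (μ.map fun ω => (X ω ∩ A).encard) :=
    Measure.isProbabilityMeasure_map hm.aemeasurable
  have h : μ.map (fun ω => (X ω ∩ A).encard) =
      (poissonMeasure (l * (volume A).toNNReal)).map ((↑) : ℕ → ℕ∞) := by
    refine eq_map_natCast_poissonMeasure fun k => ?_
    rw [Measure.map_apply hm (.of_discrete), poissonMeasure_singleton,
      ← ENNReal.ofReal_toReal (measure_ne_top μ _)]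
    congr 1
    exact hX.poisson A hA hb k
  simp only [pointMeasure_apply _ hA]
  have e := congrArg (Measure.map ((↑) : ℕ∞ → ℝ≥0∞)) h
  rw [Measure.map_map .of_discrete hm, Measure.map_map .of_discrete .of_discrete] at e
  simpa [Function.comp_def] using e

theorem IsPoissonPointProcess.iIndepFun_count (hX : IsPoissonPointProcess μ l X) {ι : Type*}
    [Finite ι] {A : ι → Set (EuclideanSpace ℝ (Fin d))} (hA : ∀ i, MeasurableSet (A i))
    (hd : Pairwise fun i j => Disjoint (A i) (A j)) :
    iIndepFun (fun i ω => pointMeasure (X ω) (A i)) μ := by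
  obtain ⟨n, ⟨e⟩⟩ := Finite.exists_equiv_fin ι
  have h := hX.indep n (fun i => A (e.symm i)) (fun i => hA _)
    fun i j hij => hd (e.symm.injective.ne hij)
  have h' := (h.precomp e.injective).comp (fun _ => ((↑) : ℕ∞ → ℝ≥0∞)) fun _ => .of_discrete
  simpa [Function.comp_def, pointMeasure_apply _ (hA _)] using h'

end PoissonProcess

/-! ### Shot noise: approximation by simple functions and superposition -/

/-- The value at `X` of the shot noise with response function `f`. -/
noncomputable def shotNoise {E : Type*} [MeasurableSpace E] (f : E → ℝ≥0∞) (X : Set E) : ℝ≥0∞ :=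
  ∫⁻ x, f x ∂pointMeasure X

/-- The value `0` is dropped because its fibre may be unbounded, while Poisson counts are available
only on bounded sets. -/
theorem lintegral_simpleFunc_comp {E : Type*} [MeasurableSpace E] {f : E → ℝ≥0∞}
    (hf : Measurable f) (g : SimpleFunc ℝ≥0∞ ℝ≥0∞) (κ : Measure E) :
    ∫⁻ x, g (f x) ∂κ = ∑ a : g.range.erase 0, (a : ℝ≥0∞) * κ (f ⁻¹' (g ⁻¹' {(a : ℝ≥0∞)})) := by
  rw [← lintegral_map g.measurable hf, SimpleFunc.lintegral_eq_lintegral, SimpleFunc.lintegral,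
    Finset.sum_coe_sort (g.range.erase 0) fun a => a * κ (f ⁻¹' (g ⁻¹' {a})),
    Finset.sum_erase _ (by simp)]
  exact Finset.sum_congr rfl fun a _ => by rw [Measure.map_apply hf (g.measurableSet_fiber a)]

/-- A supremum exceeds `t` iff some approximant does, so tails are increasing limits of tails, and
the tails determine a finite measure. -/
theorem map_eq_map_of_monotone_approx {Ω Ω' : Type*} [MeasurableSpace Ω] [MeasurableSpace Ω']
    {μ : Measure Ω} {μ' : Measure Ω'} [IsFiniteMeasure μ] {S : Ω → ℝ≥0∞} {S' : Ω' → ℝ≥0∞}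
    {T : ℕ → Ω → ℝ≥0∞} {T' : ℕ → Ω' → ℝ≥0∞} (hT : ∀ n, Measurable (T n))
    (hT' : ∀ n, Measurable (T' n)) (hmono : Monotone T) (hmono' : Monotone T')
    (hS : ∀ ω, S ω = ⨆ n, T n ω) (hS' : ∀ ω, S' ω = ⨆ n, T' n ω)
    (h : ∀ n, μ.map (T n) = μ'.map (T' n)) : μ.map S = μ'.map S' := by
  have mS : Measurable S := by rw [funext hS]; exact .iSup hT
  have mS' : Measurable S' := by rw [funext hS']; exact .iSup hT'
  have hIoi : ∀ t, (μ.map S) (Ioi t) = (μ'.map S') (Ioi t) := fun t => by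
    have e : S ⁻¹' Ioi t = ⋃ n, T n ⁻¹' Ioi t := by ext ω; simp [hS, lt_iSup_iff]
    have e' : S' ⁻¹' Ioi t = ⋃ n, T' n ⁻¹' Ioi t := by ext ω; simp [hS', lt_iSup_iff]
    have i : Monotone fun n => T n ⁻¹' Ioi t := fun m n hmn ω hω =>
      lt_of_lt_of_le hω (hmono hmn ω)
    have i' : Monotone fun n => T' n ⁻¹' Ioi t := fun m n hmn ω hω =>
      lt_of_lt_of_le hω (hmono' hmn ω)
    rw [Measure.map_apply mS measurableSet_Ioi, Measure.map_apply mS' measurableSet_Ioi, e, e',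
      i.measure_iUnion, i'.measure_iUnion]
    refine iSup_congr fun n => ?_
    rw [← Measure.map_apply (hT n) measurableSet_Ioi, h,
      Measure.map_apply (hT' n) measurableSet_Ioi]
  have huniv : (μ.map S) univ = (μ'.map S') univ := by
    have := congrArg (fun m => m univ) (h 0)
    simpa [Measure.map_apply, mS, mS', hT, hT'] using this
  have : IsFiniteMeasure (μ'.map S') := ⟨by rw [← huniv]; exact measure_lt_top _ _⟩
  refine Measure.ext_of_Iic _ _ fun t => ?_
  rw [← compl_Ioi, measure_compl measurableSet_Ioi (measure_ne_top _ _),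
    measure_compl measurableSet_Ioi (measure_ne_top _ _), huniv, hIoi]

theorem map_conv_map {Ω₁ Ω₂ M : Type*} [MeasurableSpace Ω₁] [MeasurableSpace Ω₂] [AddMonoid M]
    [MeasurableSpace M] [MeasurableAdd₂ M] {μ₁ : Measure Ω₁} {μ₂ : Measure Ω₂} [SFinite μ₁]
    [SFinite μ₂] {S₁ : Ω₁ → M} {S₂ : Ω₂ → M} (h₁ : Measurable S₁) (h₂ : Measurable S₂) :
    μ₁.map S₁ ∗ μ₂.map S₂ = (μ₁.prod μ₂).map fun p => S₁ p.1 + S₂ p.2 := by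
  rw [Measure.conv, Measure.map_prod_map _ _ h₁ h₂, Measure.map_map measurable_add (by fun_prop)]
  rfl

/-- The simple functions approximate the identity on values, not `f` itself, so that one simple
function can serve several responses at once. -/
theorem shotNoise_eq_iSup {E : Type*} [MeasurableSpace E] {f : E → ℝ≥0∞} (hf : Measurable f)
    (X : Set E) :
    shotNoise f X = ⨆ n, shotNoise (fun x => SimpleFunc.eapprox id n (f x)) X := by
  unfold shotNoise
  rw [← lintegral_iSup (f := fun n x => SimpleFunc.eapprox id n (f x))
    (fun n => (SimpleFunc.measurable _).comp hf)
    fun m n hmn x => SimpleFunc.monotone_eapprox _ hmn _]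
  exact lintegral_congr fun x => (SimpleFunc.iSup_eapprox_apply measurable_id (f x)).symm

theorem monotone_shotNoise_eapprox {E : Type*} [MeasurableSpace E] (f : E → ℝ≥0∞) (X : Set E) :
    Monotone fun n => shotNoise (fun x => SimpleFunc.eapprox id n (f x)) X := fun _ _ hmn =>
  lintegral_mono fun _ => SimpleFunc.monotone_eapprox _ hmn _

theorem IsPoissonPointProcess.measurable_shotNoise {d : ℕ} {Ω : Type*} [MeasurableSpace Ω]
    {μ : Measure Ω} {l : ℝ≥0} {X : Ω → Set (EuclideanSpace ℝ (Fin d))}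
    (hX : IsPoissonPointProcess μ l X) {f : EuclideanSpace ℝ (Fin d) → ℝ≥0∞}
    (hf : Measurable f) : Measurable fun ω => shotNoise f (X ω) :=
  (Measure.measurable_lintegral hf).comp hX.measurable_pointMeasure

theorem shotNoise_simpleFunc_comp {E Ω : Type*} [MeasurableSpace E] (X : Ω → Set E)
    {f : E → ℝ≥0∞} (hf : Measurable f) (g : SimpleFunc ℝ≥0∞ ℝ≥0∞) :
    (fun ω => shotNoise (fun x => g (f x)) (X ω)) = ∑ a : g.range.erase 0,
      fun ω => (a : ℝ≥0∞) * pointMeasure (X ω) (f ⁻¹' (g ⁻¹' {(a : ℝ≥0∞)})) := by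
  ext ω
  rw [shotNoise, lintegral_simpleFunc_comp hf, Finset.sum_apply]

/-- Superposition of independent Poisson shot noises. -/
theorem map_shotNoise_eq_conv {d : ℕ} {Ω₀ Ω₁ Ω₂ : Type*} [MeasurableSpace Ω₀]
    [MeasurableSpace Ω₁] [MeasurableSpace Ω₂] {μ₀ : Measure Ω₀} {μ₁ : Measure Ω₁}
    {μ₂ : Measure Ω₂} [IsProbabilityMeasure μ₀] [IsProbabilityMeasure μ₁]
    [IsProbabilityMeasure μ₂] {l₀ l₁ l₂ : ℝ≥0} {X₀ : Ω₀ → Set (EuclideanSpace ℝ (Fin d))}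
    {X₁ : Ω₁ → Set (EuclideanSpace ℝ (Fin d))} {X₂ : Ω₂ → Set (EuclideanSpace ℝ (Fin d))}
    (h₀ : IsPoissonPointProcess μ₀ l₀ X₀) (h₁ : IsPoissonPointProcess μ₁ l₁ X₁)
    (h₂ : IsPoissonPointProcess μ₂ l₂ X₂) {f₀ f₁ f₂ : EuclideanSpace ℝ (Fin d) → ℝ≥0∞}
    (m₀ : Measurable f₀) (m₁ : Measurable f₁) (m₂ : Measurable f₂)
    (b₀ : ∀ a ≠ 0, Bornology.IsBounded {x | a ≤ f₀ x})
    (b₁ : ∀ a ≠ 0, Bornology.IsBounded {x | a ≤ f₁ x})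
    (b₂ : ∀ a ≠ 0, Bornology.IsBounded {x | a ≤ f₂ x})
    (hv : ∀ A, MeasurableSet A → l₀ * volume (f₀ ⁻¹' A) =
      l₁ * volume (f₁ ⁻¹' A) + l₂ * volume (f₂ ⁻¹' A)) :
    μ₀.map (fun ω => shotNoise f₀ (X₀ ω)) =
      μ₁.map (fun ω => shotNoise f₁ (X₁ ω)) ∗ μ₂.map (fun ω => shotNoise f₂ (X₂ ω)) := by
  have hcell : ∀ (n : ℕ) (a : ℝ≥0∞) {f : EuclideanSpace ℝ (Fin d) → ℝ≥0∞},
      f ⁻¹' (SimpleFunc.eapprox id n ⁻¹' {a}) ⊆ {x | a ≤ f x} := by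
    intro n a f x hx
    have h1 : SimpleFunc.eapprox id n (f x) = a := hx
    rw [mem_ofPred_eq, ← h1]
    exact (le_iSup (fun n => SimpleFunc.eapprox id n (f x)) n).trans_eq
      (SimpleFunc.iSup_eapprox_apply measurable_id (f x))
  rw [map_conv_map (h₁.measurable_shotNoise m₁) (h₂.measurable_shotNoise m₂)]
  have hm : ∀ (f : EuclideanSpace ℝ (Fin d) → ℝ≥0∞), Measurable f → ∀ n,
      Measurable fun x => SimpleFunc.eapprox id n (f x) :=
    fun f hf n => (SimpleFunc.measurable _).comp hf
  have k₁ := fun n => h₁.measurable_shotNoise (hm f₁ m₁ n)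
  have k₂ := fun n => h₂.measurable_shotNoise (hm f₂ m₂ n)
  refine map_eq_map_of_monotone_approx
    (T := fun n ω => shotNoise (fun x => SimpleFunc.eapprox id n (f₀ x)) (X₀ ω))
    (T' := fun n p => shotNoise (fun x => SimpleFunc.eapprox id n (f₁ x)) (X₁ p.1) +
      shotNoise (fun x => SimpleFunc.eapprox id n (f₂ x)) (X₂ p.2))
    (fun n => h₀.measurable_shotNoise (hm f₀ m₀ n))
    (fun n => ((k₁ n).comp measurable_fst).add ((k₂ n).comp measurable_snd))
    (fun m n hmn ω => monotone_shotNoise_eapprox f₀ _ hmn)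
    (fun m n hmn ω => add_le_add (monotone_shotNoise_eapprox f₁ _ hmn)
      (monotone_shotNoise_eapprox f₂ _ hmn))
    (fun ω => shotNoise_eq_iSup m₀ _)
    (fun p => ?_) fun n => ?_
  · rw [shotNoise_eq_iSup m₁, shotNoise_eq_iSup m₂]
    exact ENNReal.iSup_add_iSup_of_monotone (monotone_shotNoise_eapprox f₁ _)
      (monotone_shotNoise_eapprox f₂ _)
  · rw [← map_conv_map (k₁ n) (k₂ n)]
    set g : SimpleFunc ℝ≥0∞ ℝ≥0∞ := SimpleFunc.eapprox id n
    have hb : ∀ {f : EuclideanSpace ℝ (Fin d) → ℝ≥0∞},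
        (∀ a ≠ 0, Bornology.IsBounded {x | a ≤ f x}) → ∀ a : g.range.erase 0,
        Bornology.IsBounded (f ⁻¹' (g ⁻¹' {(a : ℝ≥0∞)})) := fun hf a =>
      (hf a (Finset.ne_of_mem_erase a.2)).subset (hcell n a)
    have hms : ∀ {f : EuclideanSpace ℝ (Fin d) → ℝ≥0∞}, Measurable f → ∀ a : g.range.erase 0,
        MeasurableSet (f ⁻¹' (g ⁻¹' {(a : ℝ≥0∞)})) := fun hf a => hf (g.measurableSet_fiber a)
    have hdj : ∀ {f : EuclideanSpace ℝ (Fin d) → ℝ≥0∞}, Pairwise fun a a' : g.range.erase 0 =>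
        Disjoint (f ⁻¹' (g ⁻¹' {(a : ℝ≥0∞)})) (f ⁻¹' (g ⁻¹' {(a' : ℝ≥0∞)})) := fun {f} a a' haa =>
      ((disjoint_singleton.2 (Subtype.coe_injective.ne haa)).preimage g).preimage f
    -- This is where the volume hypothesis enters: on each level cell, the Poisson parameters add
    -- up.
    have hr : ∀ a : g.range.erase 0,
        l₀ * (volume (f₀ ⁻¹' (g ⁻¹' {(a : ℝ≥0∞)}))).toNNReal =
          l₁ * (volume (f₁ ⁻¹' (g ⁻¹' {(a : ℝ≥0∞)}))).toNNReal +
          l₂ * (volume (f₂ ⁻¹' (g ⁻¹' {(a : ℝ≥0∞)}))).toNNReal := fun a => by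
      rw [← ENNReal.coe_inj]
      push_cast
      rw [ENNReal.coe_toNNReal (hb b₀ a).measure_lt_top.ne,
        ENNReal.coe_toNNReal (hb b₁ a).measure_lt_top.ne,
        ENNReal.coe_toNNReal (hb b₂ a).measure_lt_top.ne]
      exact hv _ (g.measurableSet_fiber a)
    rw [shotNoise_simpleFunc_comp X₀ m₀, shotNoise_simpleFunc_comp X₁ m₁,
      shotNoise_simpleFunc_comp X₂ m₂]
    refine map_weighted_poisson_sum (h₀.iIndepFun_count (hms m₀) hdj)
      (h₁.iIndepFun_count (hms m₁) hdj) (h₂.iIndepFun_count (hms m₂) hdj)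
      (fun a => (Measure.measurable_coe (hms m₀ a)).comp h₀.measurable_pointMeasure)
      (fun a => (Measure.measurable_coe (hms m₁ a)).comp h₁.measurable_pointMeasure)
      (fun a => (Measure.measurable_coe (hms m₂ a)).comp h₂.measurable_pointMeasure)
      (fun a => ?_) (fun a => h₁.map_count (hms m₁ a) (hb b₁ a))
      (fun a => h₂.map_count (hms m₂ a) (hb b₂ a)) _ _
    rw [← hr]
    exact h₀.map_count (hms m₀ a) (hb b₀ a)

/-! ### First and second moment measures of a Poisson point process -/

theorem lintegral_poissonMeasure (r : ℝ≥0) (g : ℕ → ℝ≥0∞) :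
    ∫⁻ n, g n ∂poissonMeasure r =
      ∑' n, ENNReal.ofReal (Real.exp (-r) * r ^ n / (n !)) * g n := by
  simp [poissonMeasure, lintegral_sum_measure]

/-- Size biasing: `n * p n = r * p (n - 1)` for the Poisson weights. Both moments below follow. -/
theorem lintegral_natCast_mul_poissonMeasure (r : ℝ≥0) (g : ℕ → ℝ≥0∞) :
    ∫⁻ n, n * g n ∂poissonMeasure r = r * ∫⁻ n, g (n + 1) ∂poissonMeasure r := by
  rw [lintegral_poissonMeasure, lintegral_poissonMeasure, tsum_eq_zero_add' ENNReal.summable,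
    ← ENNReal.tsum_mul_left]
  simp only [Nat.cast_zero, zero_mul, mul_zero, zero_add]
  refine tsum_congr fun n => ?_
  rw [← mul_assoc, ← mul_assoc, ← ENNReal.ofReal_natCast, ← ENNReal.ofReal_coe_nnreal,
    ← ENNReal.ofReal_mul (by positivity), ← ENNReal.ofReal_mul (by positivity)]
  congr 2
  rw [Nat.factorial_succ]
  push_cast
  have : ((n : ℝ) + 1) ≠ 0 := by positivity
  field_simp
  ring

theorem lintegral_natCast_poissonMeasure (r : ℝ≥0) :
    ∫⁻ n, (n : ℝ≥0∞) ∂poissonMeasure r = r := by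
  simpa using lintegral_natCast_mul_poissonMeasure r fun _ => 1

theorem lintegral_natCast_mul_self_poissonMeasure (r : ℝ≥0) :
    ∫⁻ n, (n : ℝ≥0∞) * n ∂poissonMeasure r = r * r + r := by
  rw [lintegral_natCast_mul_poissonMeasure r fun n => (n : ℝ≥0∞)]
  simp only [Nat.cast_add, Nat.cast_one]
  rw [lintegral_add_right _ measurable_const, lintegral_natCast_poissonMeasure]
  simp [mul_add]

section Moments

variable {d : ℕ} {Ω : Type*} [MeasurableSpace Ω] {μ : Measure Ω} {l : ℝ≥0}
  {X : Ω → Set (EuclideanSpace ℝ (Fin d))} {A B : Set (EuclideanSpace ℝ (Fin d))}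

theorem IsPoissonPointProcess.measurable_pointMeasure_apply (hX : IsPoissonPointProcess μ l X)
    (hA : MeasurableSet A) : Measurable fun ω => pointMeasure (X ω) A :=
  (Measure.measurable_coe hA).comp hX.measurable_pointMeasure

theorem IsPoissonPointProcess.indepFun_count (hX : IsPoissonPointProcess μ l X)
    (hA : MeasurableSet A) (hB : MeasurableSet B) (hd : Disjoint A B) :
    IndepFun (fun ω => pointMeasure (X ω) A) (fun ω => pointMeasure (X ω) B) μ := by
  have h := hX.iIndepFun_count (A := ![A, B]) (fun i => by fin_cases i <;> simpa)
    (fun i j hij => by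
      fin_cases i <;> fin_cases j <;> first | exact absurd rfl hij | exact hd | exact hd.symm)
  exact h.indepFun (i := 0) (j := 1) (by decide)

variable [IsProbabilityMeasure μ]

theorem IsPoissonPointProcess.lintegral_comp_count (hX : IsPoissonPointProcess μ l X)
    (hA : MeasurableSet A) (hb : Bornology.IsBounded A) {g : ℝ≥0∞ → ℝ≥0∞} (hg : Measurable g) :
    ∫⁻ ω, g (pointMeasure (X ω) A) ∂μ =
      ∫⁻ n, g n ∂poissonMeasure (l * (volume A).toNNReal) := by
  rw [← lintegral_map hg (hX.measurable_pointMeasure_apply hA), hX.map_count hA hb,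
    lintegral_map hg .of_discrete]

theorem IsPoissonPointProcess.lintegral_count (hX : IsPoissonPointProcess μ l X)
    (hA : MeasurableSet A) (hb : Bornology.IsBounded A) :
    ∫⁻ ω, pointMeasure (X ω) A ∂μ = l * volume A := by
  rw [hX.lintegral_comp_count hA hb (g := fun x => x) measurable_id]
  simp only [lintegral_natCast_poissonMeasure, ENNReal.coe_mul]
  rw [ENNReal.coe_toNNReal hb.measure_lt_top.ne]

theorem IsPoissonPointProcess.lintegral_count_mul_self (hX : IsPoissonPointProcess μ l X)
    (hA : MeasurableSet A) (hb : Bornology.IsBounded A) :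
    ∫⁻ ω, pointMeasure (X ω) A * pointMeasure (X ω) A ∂μ =
      l ^ 2 * (volume A * volume A) + l * volume A := by
  rw [hX.lintegral_comp_count hA hb (g := fun x => x * x) (by fun_prop)]
  simp only [lintegral_natCast_mul_self_poissonMeasure, ENNReal.coe_mul]
  rw [ENNReal.coe_toNNReal hb.measure_lt_top.ne]
  ring

theorem IsPoissonPointProcess.lintegral_count_mul_count_of_disjoint
    (hX : IsPoissonPointProcess μ l X) (hA : MeasurableSet A) (hB : MeasurableSet B)
    (hbA : Bornology.IsBounded A) (hbB : Bornology.IsBounded B) (hd : Disjoint A B) :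
    ∫⁻ ω, pointMeasure (X ω) A * pointMeasure (X ω) B ∂μ = l ^ 2 * (volume A * volume B) := by
  have h := lintegral_mul_eq_lintegral_mul_lintegral_of_indepFun
    (hX.measurable_pointMeasure_apply hA) (hX.measurable_pointMeasure_apply hB)
    (hX.indepFun_count hA hB hd)
  simp only [Pi.mul_apply] at h
  rw [h, hX.lintegral_count hA hbA, hX.lintegral_count hB hbB]
  ring

/-- Splitting along `A ∩ B` leaves products of counts on disjoint sets and one square, that of the
count on `A ∩ B`, whose extra term is `l * volume (A ∩ B)`. -/
theorem IsPoissonPointProcess.lintegral_count_mul_count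
    (hX : IsPoissonPointProcess μ l X) (hA : MeasurableSet A) (hB : MeasurableSet B)
    (hbA : Bornology.IsBounded A) (hbB : Bornology.IsBounded B) :
    ∫⁻ ω, pointMeasure (X ω) A * pointMeasure (X ω) B ∂μ =
      l ^ 2 * (volume A * volume B) + l * volume (A ∩ B) := by
  have e : ∀ (ρ : Measure (EuclideanSpace ℝ (Fin d))),
      ρ A = ρ (A \ B) + ρ (A ∩ B) ∧ ρ B = ρ (B \ A) + ρ (A ∩ B) := fun ρ =>
    ⟨(measure_sdiff_add_inter A hB).symm, by rw [inter_comm, measure_sdiff_add_inter B hA]⟩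
  have hC := hA.inter hB
  have hbC := hbA.subset (inter_subset_left (t := B))
  have hbA' := hbA.subset (sdiff_subset (t := B))
  have hbB' := hbB.subset (sdiff_subset (t := A))
  have mA := hX.measurable_pointMeasure_apply (hA.diff hB)
  have mB := hX.measurable_pointMeasure_apply (hB.diff hA)
  have mC := hX.measurable_pointMeasure_apply hC
  have h : ∀ ω, pointMeasure (X ω) A * pointMeasure (X ω) B =
      pointMeasure (X ω) (A \ B) * pointMeasure (X ω) (B \ A) +
      pointMeasure (X ω) (A \ B) * pointMeasure (X ω) (A ∩ B) +
      pointMeasure (X ω) (A ∩ B) * pointMeasure (X ω) (B \ A) +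
      pointMeasure (X ω) (A ∩ B) * pointMeasure (X ω) (A ∩ B) := fun ω => by
    rw [(e (pointMeasure (X ω))).1, (e (pointMeasure (X ω))).2]
    ring
  simp_rw [h]
  rw [lintegral_add_right _ (by fun_prop), lintegral_add_right _ (by fun_prop),
    lintegral_add_right _ (by fun_prop), hX.lintegral_count_mul_self hC hbC,
    hX.lintegral_count_mul_count_of_disjoint (hA.diff hB) (hB.diff hA) hbA' hbB'
      (disjoint_sdiff_sdiff),
    hX.lintegral_count_mul_count_of_disjoint (hA.diff hB) hC hbA' hbC
      (disjoint_sdiff_self_left.mono_right inter_subset_right),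
    hX.lintegral_count_mul_count_of_disjoint hC (hB.diff hA) hbC hbB'
      (disjoint_sdiff_self_right.mono_left inter_subset_left), (e volume).1, (e volume).2]
  ring

end Moments

/-! ### The second moment measure -/

/-- The points of `X` in `B`, provided that there are only finitely many of them. -/
noncomputable def finitePoints {E : Type*} (X B : Set E) : Set E :=
  open Classical in if (X ∩ B).encard < ⊤ then X ∩ B else ∅

theorem finite_finitePoints {E : Type*} (X B : Set E) : (finitePoints X B).Finite := by
  unfold finitePoints
  split_ifs with h
  · exact encard_lt_top_iff.1 h
  · exact finite_empty

/-- Finiteness for every `ω`, not just almost every one, lets the product measures be formed and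
depend measurably on `ω`. -/
instance {E : Type*} [MeasurableSpace E] (X B : Set E) :
    IsFiniteMeasure (pointMeasure (finitePoints X B)) :=
  ⟨by
    rw [pointMeasure_apply _ .univ, inter_univ]
    simpa using finite_finitePoints X B⟩

theorem IsPoissonPointProcess.measurable_finitePoints {d : ℕ} {Ω : Type*} [MeasurableSpace Ω]
    {μ : Measure Ω} {l : ℝ≥0} {X : Ω → Set (EuclideanSpace ℝ (Fin d))}
    (hX : IsPoissonPointProcess μ l X) {B : Set (EuclideanSpace ℝ (Fin d))}
    (hB : MeasurableSet B) : Measurable fun ω => pointMeasure (finitePoints (X ω) B) := by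
  classical
  refine Measure.measurable_of_measurable_coe _ fun A hA => ?_
  have : ∀ ω, pointMeasure (finitePoints (X ω) B) A =
      if (X ω ∩ B).encard < ⊤ then pointMeasure (X ω) (B ∩ A) else 0 := fun ω => by
    unfold finitePoints
    split_ifs
    · rw [pointMeasure_apply _ hA, pointMeasure_apply _ (hB.inter hA), inter_assoc]
    · rw [pointMeasure_apply _ hA]; simp
  simp_rw [this]
  exact Measurable.ite (hX.measurable_count B hB (.of_discrete (s := {n | n < ⊤})))
    (hX.measurable_pointMeasure_apply (hB.inter hA)) measurable_const

theorem IsPoissonPointProcess.ae_finite {d : ℕ} {Ω : Type*} [MeasurableSpace Ω]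
    {μ : Measure Ω} [IsProbabilityMeasure μ] {l : ℝ≥0} {X : Ω → Set (EuclideanSpace ℝ (Fin d))}
    (hX : IsPoissonPointProcess μ l X) {B : Set (EuclideanSpace ℝ (Fin d))}
    (hB : MeasurableSet B) (hb : Bornology.IsBounded B) : ∀ᵐ ω ∂μ, (X ω ∩ B).Finite := by
  have h := ae_lt_top (hX.measurable_pointMeasure_apply hB) (by
    rw [hX.lintegral_count hB hb]
    exact ENNReal.mul_ne_top ENNReal.coe_ne_top hb.measure_lt_top.ne)
  filter_upwards [h] with ω hω
  rw [pointMeasure_apply _ hB] at hω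
  simpa using hω

theorem IsPoissonPointProcess.measurable_finitePoints_prod {d : ℕ} {Ω : Type*}
    [MeasurableSpace Ω] {μ : Measure Ω} {l : ℝ≥0} {X : Ω → Set (EuclideanSpace ℝ (Fin d))}
    (hX : IsPoissonPointProcess μ l X) {B : Set (EuclideanSpace ℝ (Fin d))}
    (hB : MeasurableSet B) : Measurable fun ω =>
      (pointMeasure (finitePoints (X ω) B)).prod (pointMeasure (finitePoints (X ω) B)) := by
  have hk := hX.measurable_finitePoints hB
  refine Measurable.measure_of_isPiSystem generateFrom_prod.symm isPiSystem_prod ?_ ?_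
  · rintro _ ⟨s, hs : MeasurableSet s, t, ht : MeasurableSet t, rfl⟩
    simp_rw [Measure.prod_prod]
    exact ((Measure.measurable_coe hs).comp hk).mul ((Measure.measurable_coe ht).comp hk)
  · simp_rw [← univ_prod_univ, Measure.prod_prod]
    exact ((Measure.measurable_coe .univ).comp hk).mul ((Measure.measurable_coe .univ).comp hk)

/-- The second moment measure of a Poisson point process. -/
theorem IsPoissonPointProcess.lintegral_lintegral_prod {d : ℕ} {Ω : Type*} [MeasurableSpace Ω]
    {μ : Measure Ω} [IsProbabilityMeasure μ] {l : ℝ≥0} {X : Ω → Set (EuclideanSpace ℝ (Fin d))}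
    (hX : IsPoissonPointProcess μ l X) {B : Set (EuclideanSpace ℝ (Fin d))}
    (hB : MeasurableSet B) (hb : Bornology.IsBounded B)
    {h : EuclideanSpace ℝ (Fin d) × EuclideanSpace ℝ (Fin d) → ℝ≥0∞} (hh : Measurable h) :
    ∫⁻ ω, ∫⁻ z, h z ∂((pointMeasure (finitePoints (X ω) B)).prod
      (pointMeasure (finitePoints (X ω) B))) ∂μ =
      l ^ 2 * ∫⁻ z, h z ∂((volume.restrict B).prod (volume.restrict B)) +
      l * ∫⁻ x in B, h (x, x) := by
  have hfin : IsFiniteMeasure (volume.restrict B) := ⟨by simpa using hb.measure_lt_top⟩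
  have hm := hX.measurable_finitePoints_prod hB
  have hdiag : Measurable fun x : EuclideanSpace ℝ (Fin d) => (x, x) := by fun_prop
  -- Both sides are determined by their values on rectangles, where the claim is the mixed moment of
  -- two counts.
  have key : Measure.bind μ (fun ω => (pointMeasure (finitePoints (X ω) B)).prod
      (pointMeasure (finitePoints (X ω) B))) =
      (l : ℝ≥0∞) ^ 2 • (volume.restrict B).prod (volume.restrict B) +
        (l : ℝ≥0∞) • (volume.restrict B).map fun x => (x, x) := by
    have hrect : ∀ s t, MeasurableSet s → MeasurableSet t →
        Measure.bind μ (fun ω => (pointMeasure (finitePoints (X ω) B)).prod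
        (pointMeasure (finitePoints (X ω) B))) (s ×ˢ t) =
        ((l : ℝ≥0∞) ^ 2 • (volume.restrict B).prod (volume.restrict B) +
        (l : ℝ≥0∞) • (volume.restrict B).map fun x => (x, x)) (s ×ˢ t) := by
      intro s t hs ht
      rw [Measure.bind_apply (hs.prod ht) hm.aemeasurable]
      simp only [Measure.add_apply, Measure.smul_apply, smul_eq_mul, Measure.prod_prod]
      rw [Measure.map_apply hdiag (hs.prod ht), Measure.restrict_apply hs,
        Measure.restrict_apply ht, Measure.restrict_apply (hdiag (hs.prod ht))]
      have := hX.lintegral_count_mul_count (hs.inter hB) (ht.inter hB)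
        (hb.subset inter_subset_right) (hb.subset inter_subset_right)
      rw [show (fun x : EuclideanSpace ℝ (Fin d) => (x, x)) ⁻¹' s ×ˢ t ∩ B =
        (s ∩ B) ∩ (t ∩ B) by ext; simp; tauto, ← this]
      refine lintegral_congr_ae ?_
      filter_upwards [hX.ae_finite hB hb] with ω hω
      have e : ∀ u, MeasurableSet u → pointMeasure (finitePoints (X ω) B) u =
          pointMeasure (X ω) (u ∩ B) := fun u hu => by
        rw [finitePoints, if_pos (encard_lt_top_iff.2 hω), pointMeasure_apply _ hu,
          pointMeasure_apply _ (hu.inter hB), inter_assoc, inter_comm B]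
      rw [e s hs, e t ht]
    have hfin' : IsFiniteMeasure ((l : ℝ≥0∞) ^ 2 • (volume.restrict B).prod (volume.restrict B) +
        (l : ℝ≥0∞) • (volume.restrict B).map fun x => (x, x)) := by
      refine ⟨?_⟩
      simp only [Measure.add_apply, Measure.smul_apply, smul_eq_mul]
      exact ENNReal.add_lt_top.2 ⟨ENNReal.mul_lt_top (by simp) (measure_lt_top _ _),
        ENNReal.mul_lt_top (by simp) (measure_lt_top _ _)⟩
    symm
    refine ext_of_generate_finite _ generateFrom_prod.symm isPiSystem_prod ?_ ?_
    · rintro _ ⟨s, hs, t, ht, rfl⟩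
      exact (hrect s t hs ht).symm
    · rw [← univ_prod_univ]
      exact (hrect _ _ .univ .univ).symm
  rw [← Measure.lintegral_bind hm.aemeasurable hh.aemeasurable, key, lintegral_add_measure,
    lintegral_smul_measure, lintegral_smul_measure, lintegral_map hh hdiag, smul_eq_mul,
    smul_eq_mul]

/-! ### Large values of a shot noise without large summands -/

/-- Either some term reaches `1` after division by `ε`, or no truncation takes place and the sum is
the total divided by `ε`. -/
theorem one_le_tsum_min_div {ι : Type*} {g : ι → ℝ≥0∞} {ε : ℝ≥0∞} (hε : ε ≠ ∞)
    (h : ε < ∑' i, g i) : 1 ≤ ∑' i, min 1 (g i / ε) := by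
  by_cases hi : ∃ i, 1 ≤ g i / ε
  · obtain ⟨i, hi⟩ := hi
    exact (le_min le_rfl hi).trans (ENNReal.le_tsum i)
  · push Not at hi
    have h0 : ε ≠ 0 := by
      rintro rfl
      refine h.ne' (ENNReal.tsum_eq_zero.2 fun i => ?_)
      by_contra hne
      have := hi i
      rw [ENNReal.div_zero hne] at this
      exact absurd this (by simp)
    simp_rw [min_eq_right (hi _).le, div_eq_mul_inv, ENNReal.tsum_mul_right]
    rw [← div_eq_mul_inv, ENNReal.le_div_iff_mul_le (.inl h0) (.inl hε), one_mul]
    exact h.le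

/-- A pair interaction whose sum over the pairs of distinct points is at least `1` if all values
of `f` are at most `b` and their sum exceeds `b`. -/
noncomputable def pairInteraction {E : Type*} (f : E → ℝ≥0∞) (b : ℝ≥0∞) (z : E × E) : ℝ≥0∞ :=
  open Classical in
  if z.1 = z.2 ∨ b < f z.1 then 0 else f z.1 / b * min 1 (f z.2 / (b - f z.1))

section Pair

variable {E : Type*} [MeasurableSpace E] {f : E → ℝ≥0∞} {b : ℝ≥0∞}

theorem measurable_pairInteraction [MeasurableEq E] (hf : Measurable f) :
    Measurable (pairInteraction f b) := by
  classical
  unfold pairInteraction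
  refine Measurable.ite ?_ measurable_const (by fun_prop)
  exact (measurableSet_eq_fun measurable_fst measurable_snd).union
    (measurableSet_lt measurable_const (hf.comp measurable_fst))

/-- Given `x`, the other points sum to more than `b - f x`, so their truncated quotients sum to at
least `1`, and the inner sum is at least `f x / b`. Summing over `x` gives more than `b / b`. The
truncation at `1` keeps the integral over `y` finite near the pole of the power law. -/
theorem one_le_lintegral_pairInteraction [MeasurableEq E] (hf : Measurable f) (hb0 : b ≠ 0)
    (hb : b ≠ ∞) (X : Set E) [IsFiniteMeasure (pointMeasure X)] (hX : ∀ x ∈ X, f x ≤ b)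
    (hS : b < shotNoise f X) :
    1 ≤ ∫⁻ z, pairInteraction f b z ∂((pointMeasure X).prod (pointMeasure X)) := by
  classical
  have hm := measurable_pairInteraction (b := b) hf
  rw [lintegral_prod _ hm.aemeasurable, lintegral_pointMeasure _ hm.lintegral_prod_right']
  rw [shotNoise, lintegral_pointMeasure _ hf] at hS
  have h1 : ∀ x : X, f x / b ≤ ∫⁻ y, pairInteraction f b (x, y) ∂pointMeasure X := fun x => by
    rw [lintegral_pointMeasure _ (g := fun y => pairInteraction f b (x, y))
      (hm.comp measurable_prodMk_left)]
    have hlt : b - f x < ∑' y : X, if y = x then 0 else f y := by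
      rw [ENNReal.tsum_eq_add_tsum_ite x] at hS
      rw [ENNReal.sub_lt_iff_lt_left ((hX x x.2).trans_lt hb.lt_top).ne (hX x x.2)]
      convert hS
    have h2 := one_le_tsum_min_div (ne_top_of_le_ne_top hb tsub_le_self) hlt
    calc f x / b = f x / b * 1 := (mul_one _).symm
      _ ≤ f x / b * ∑' y : X, min 1 ((if y = x then 0 else f y) / (b - f x)) := by gcongr
      _ = ∑' y : X, pairInteraction f b (x, y) := by
        rw [← ENNReal.tsum_mul_left]
        refine tsum_congr fun y => ?_
        unfold pairInteraction
        by_cases hxy : y = x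
        · simp [hxy]
        · have : ¬ ((x : E) = y ∨ b < f x) := by
            rintro (h | h)
            · exact hxy (Subtype.ext h.symm)
            · exact (hX x x.2).not_gt h
          simp only [if_neg hxy, if_neg this]
  calc (1 : ℝ≥0∞) ≤ (∑' x : X, f x) / b := by
        rw [ENNReal.le_div_iff_mul_le (.inl hb0) (.inl hb), one_mul]
        exact hS.le
    _ = ∑' x : X, f x / b := by simp_rw [div_eq_mul_inv, ENNReal.tsum_mul_right]
    _ ≤ _ := ENNReal.tsum_le_tsum h1

end Pair

theorem shotNoise_mono {E : Type*} [MeasurableSpace E] {f : E → ℝ≥0∞} (hf : Measurable f)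
    {X Y : Set E} (h : X ⊆ Y) : shotNoise f X ≤ shotNoise f Y := by
  rw [shotNoise, shotNoise, lintegral_pointMeasure _ hf, lintegral_pointMeasure _ hf]
  exact ENNReal.tsum_mono_subtype f h

theorem exists_lt_shotNoise_inter_ball {E : Type*} [SeminormedAddCommGroup E] [MeasurableSpace E]
    [OpensMeasurableSpace E] {f : E → ℝ≥0∞} {b : ℝ≥0∞}
    {X : Set E} (h : b < shotNoise f X) :
    ∃ n : ℕ, b < shotNoise f (X ∩ Metric.ball 0 n) := by
  have hmono : Monotone fun n : ℕ => Metric.ball (0 : E) n := fun m n hmn =>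
    Metric.ball_subset_ball (by exact_mod_cast hmn)
  have := setLIntegral_iUnion_of_directed (μ := pointMeasure X) f hmono.directed_le
  rw [Metric.iUnion_ball_nat, setLIntegral_univ] at this
  rw [shotNoise, this, lt_iSup_iff] at h
  obtain ⟨n, hn⟩ := h
  exact ⟨n, by rwa [shotNoise, ← pointMeasure_restrict _ measurableSet_ball]⟩

/-- Markov's inequality for the pair sum over the points in a ball, uniformly in the radius. The
order is `l ^ 2` because the interaction vanishes on the diagonal, which kills the linear term of
the second moment measure. -/
theorem IsPoissonPointProcess.measure_shotNoise_gt_le {d : ℕ} {Ω : Type*} [MeasurableSpace Ω]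
    {μ : Measure Ω} [IsProbabilityMeasure μ] {l : ℝ≥0} {X : Ω → Set (EuclideanSpace ℝ (Fin d))}
    (hX : IsPoissonPointProcess μ l X) {f : EuclideanSpace ℝ (Fin d) → ℝ≥0∞}
    (hf : Measurable f) {b : ℝ≥0∞} (hb0 : b ≠ 0) (hb : b ≠ ∞) :
    μ {ω | (∀ x ∈ X ω, f x ≤ b) ∧ b < shotNoise f (X ω)} ≤
      l ^ 2 * ∫⁻ x, ∫⁻ y, pairInteraction f b (x, y) := by
  have hm := measurable_pairInteraction (b := b) hf
  set G : ℕ → Set Ω := fun n => {ω | (∀ k : ℕ, (X ω ∩ Metric.ball 0 k).Finite) ∧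
    (∀ x ∈ X ω, f x ≤ b) ∧ b < shotNoise f (X ω ∩ Metric.ball 0 n)} with hG
  have hGm : Monotone G := fun m n hmn ω hω => ⟨hω.1, hω.2.1, hω.2.2.trans_le
    (shotNoise_mono hf (inter_subset_inter_right _
      (Metric.ball_subset_ball (by exact_mod_cast hmn))))⟩
  have hfin : ∀ᵐ ω ∂μ, ∀ k : ℕ, (X ω ∩ Metric.ball 0 k).Finite :=
    ae_all_iff.2 fun k => hX.ae_finite measurableSet_ball Metric.isBounded_ball
  have hle : μ {ω | (∀ x ∈ X ω, f x ≤ b) ∧ b < shotNoise f (X ω)} ≤ μ (⋃ n, G n) := by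
    refine measure_mono_ae ?_
    filter_upwards [hfin] with ω hω h
    obtain ⟨n, hn⟩ := exists_lt_shotNoise_inter_ball h.2
    exact mem_iUnion.2 ⟨n, hω, h.1, hn⟩
  refine hle.trans ?_
  rw [hGm.measure_iUnion]
  refine iSup_le fun n => ?_
  set B : Set (EuclideanSpace ℝ (Fin d)) := Metric.ball 0 n
  set U : Ω → ℝ≥0∞ := fun ω => ∫⁻ z, pairInteraction f b z
    ∂((pointMeasure (finitePoints (X ω) B)).prod (pointMeasure (finitePoints (X ω) B))) with hU
  have hGU : G n ⊆ {ω | 1 ≤ U ω} := fun ω hω => by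
    have e : finitePoints (X ω) B = X ω ∩ B := by
      rw [finitePoints, if_pos (encard_lt_top_iff.2 (hω.1 n))]
    refine one_le_lintegral_pairInteraction hf hb0 hb _ (fun x hx => hω.2.1 x ?_) ?_
    · rw [e] at hx; exact hx.1
    · rw [e]; exact hω.2.2
  have h1 : μ {ω | 1 ≤ U ω} ≤ ∫⁻ ω, U ω ∂μ := by
    have hU' : Measurable U :=
      (Measure.measurable_lintegral hm).comp (hX.measurable_finitePoints_prod measurableSet_ball)
    simpa using mul_meas_ge_le_lintegral (μ := μ) hU' 1
  refine (measure_mono hGU).trans (h1.trans ?_)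
  rw [hU, hX.lintegral_lintegral_prod measurableSet_ball Metric.isBounded_ball hm]
  have h0 : ∀ x, pairInteraction f b (x, x) = 0 := fun x => by simp [pairInteraction]
  simp only [h0, lintegral_zero, mul_zero, add_zero]
  gcongr
  rw [lintegral_prod _ hm.aemeasurable]
  exact (lintegral_mono fun x => setLIntegral_le_lintegral _ _).trans
    (setLIntegral_le_lintegral _ _)

/-! ### The power law response -/

/-- The power law `x ↦ |x| ^ (-α)`. -/
noncomputable def powerLaw {E : Type*} [Norm E] (α : ℝ) (x : E) : ℝ≥0∞ :=
  ENNReal.ofReal ‖x‖ ^ (-α)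

section PowerLaw

variable {E : Type*} [NormedAddCommGroup E] {α : ℝ}

theorem measurable_powerLaw [MeasurableSpace E] [OpensMeasurableSpace E] :
    Measurable (powerLaw α : E → ℝ≥0∞) := by
  unfold powerLaw
  fun_prop

theorem lt_powerLaw_iff (hα : 0 < α) {b : ℝ} (hb : 0 < b) (x : E) :
    ENNReal.ofReal b < powerLaw α x ↔ ‖x‖ < b ^ (-α⁻¹) := by
  rw [powerLaw, ENNReal.rpow_neg, ← ENNReal.inv_rpow, ← ENNReal.rpow_inv_lt_iff hα,
    ENNReal.lt_inv_iff_lt_inv, ENNReal.ofReal_rpow_of_pos hb,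
    ← ENNReal.ofReal_inv_of_pos (by positivity), ← Real.rpow_neg hb.le,
    ENNReal.ofReal_lt_ofReal_iff (by positivity)]

theorem powerLaw_eq_ofReal {x : E} (hx : x ≠ 0) : powerLaw α x = ENNReal.ofReal (‖x‖ ^ (-α)) := by
  rw [powerLaw, ENNReal.ofReal_rpow_of_pos (norm_pos_iff.2 hx)]

theorem isBounded_le_powerLaw (hα : 0 < α) {a : ℝ≥0∞} (ha : a ≠ 0) :
    Bornology.IsBounded {x : E | a ≤ powerLaw α x} := by
  obtain ⟨c, hc0, hca⟩ := ENNReal.lt_iff_exists_nnreal_btwn.1 (pos_iff_ne_zero.2 ha)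
  have hc : 0 < (c : ℝ) := by exact_mod_cast hc0
  refine (Metric.isBounded_ball (x := (0 : E)) (r := (c : ℝ) ^ (-α⁻¹))).subset fun x hx => ?_
  rw [mem_ball_zero_iff, ← lt_powerLaw_iff hα hc, ENNReal.ofReal_coe_nnreal]
  exact hca.trans_le hx

theorem powerLaw_smul [NormedSpace ℝ E] {k : ℝ} (hk : 0 < k) (x : E) :
    powerLaw α (k • x) = ENNReal.ofReal (k ^ (-α)) * powerLaw α x := by
  rw [powerLaw, norm_smul, Real.norm_of_nonneg hk.le, ENNReal.ofReal_mul hk.le,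
    ENNReal.mul_rpow_of_ne_top ENNReal.ofReal_ne_top ENNReal.ofReal_ne_top,
    ENNReal.ofReal_rpow_of_pos hk, powerLaw]

theorem const_mul_powerLaw [NormedSpace ℝ E] (hα : 0 < α) {c : ℝ} (hc : 0 < c) (x : E) :
    ENNReal.ofReal c * powerLaw α x = powerLaw α (c ^ (-α⁻¹) • x) := by
  rw [powerLaw_smul (by positivity), ← Real.rpow_mul hc.le]
  simp [hα.ne']

end PowerLaw

section Volume

variable {d : ℕ} {α : ℝ}

/-- Multiplying the response by `c` is the same as contracting space by `c ^ (-1/α)`. This is the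
source of the exponent `d / α`. -/
theorem volume_preimage_const_mul_powerLaw (hα : 0 < α) {c : ℝ} (hc : 0 < c) (A : Set ℝ≥0∞) :
    volume ((fun x : EuclideanSpace ℝ (Fin d) => ENNReal.ofReal c * powerLaw α x) ⁻¹' A) =
      ENNReal.ofReal (c ^ (d / α)) *
        volume ((powerLaw α : EuclideanSpace ℝ (Fin d) → ℝ≥0∞) ⁻¹' A) := by
  have h : 0 < c ^ (-α⁻¹) := by positivity
  simp_rw [const_mul_powerLaw hα hc]
  rw [show (fun x : EuclideanSpace ℝ (Fin d) => powerLaw α (c ^ (-α⁻¹) • x)) ⁻¹' A =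
    (fun x => c ^ (-α⁻¹) • x) ⁻¹' (powerLaw α ⁻¹' A) from rfl,
    Measure.addHaar_preimage_smul _ h.ne', finrank_euclideanSpace_fin, abs_of_pos (by positivity),
    ← Real.rpow_mul_natCast hc.le, ← Real.rpow_neg hc.le]
  congr 3
  ring

theorem lintegral_min_one_powerLaw_lt_top (hα : (d : ℝ) < α) :
    ∫⁻ y : EuclideanSpace ℝ (Fin d), min 1 (powerLaw α y) < ∞ := by
  have hα0 : 0 < α := (Nat.cast_nonneg d).trans_lt hα
  have h := finite_integral_one_add_norm (E := EuclideanSpace ℝ (Fin d)) (μ := volume)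
    (by rwa [finrank_euclideanSpace_fin])
  -- The constant `2 ^ α` works because `1 + ‖y‖ ≤ 2 * max 1 ‖y‖`.
  refine lt_of_le_of_lt (lintegral_mono fun y => ?_)
    ((lintegral_const_mul' (ENNReal.ofReal (2 ^ α)) _ ENNReal.ofReal_ne_top).trans_lt
      (ENNReal.mul_lt_top ENNReal.ofReal_lt_top h))
  rw [← ENNReal.ofReal_mul (by positivity)]
  by_cases hy : ‖y‖ ≤ 1
  · refine (min_le_left _ _).trans ?_
    rw [ENNReal.one_le_ofReal, Real.rpow_neg (by positivity), ← div_eq_mul_inv,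
      one_le_div (by positivity)]
    gcongr
    linarith
  · push Not at hy
    refine (min_le_right _ _).trans ?_
    rw [powerLaw_eq_ofReal (norm_pos_iff.1 (by linarith))]
    refine ENNReal.ofReal_le_ofReal ?_
    rw [Real.rpow_neg (by positivity), Real.rpow_neg (by positivity), ← div_eq_mul_inv,
      ← Real.div_rpow (by positivity) (by positivity), ← Real.inv_rpow (by positivity)]
    refine Real.rpow_le_rpow (by positivity) ?_ hα0.le
    rw [inv_eq_one_div, div_le_div_iff₀ (by linarith) (by linarith)]
    linarith

theorem lintegral_min_one_powerLaw_div (hα : 0 < α) {ε : ℝ} (hε : 0 < ε) :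
    ∫⁻ y : EuclideanSpace ℝ (Fin d), min 1 (powerLaw α y / ENNReal.ofReal ε) =
      ENNReal.ofReal (ε ^ (-(d / α))) *
        ∫⁻ y : EuclideanSpace ℝ (Fin d), min 1 (powerLaw α y) := by
  have hm : Measurable (powerLaw α : EuclideanSpace ℝ (Fin d) → ℝ≥0∞) := measurable_powerLaw
  have e : ∀ y : EuclideanSpace ℝ (Fin d), powerLaw α y / ENNReal.ofReal ε =
      ENNReal.ofReal ε⁻¹ * powerLaw α y := fun y => by
    rw [ENNReal.ofReal_inv_of_pos hε, div_eq_mul_inv, mul_comm]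
  simp_rw [e]
  rw [← lintegral_map (f := fun t => min 1 t) (g := fun y : EuclideanSpace ℝ (Fin d) =>
      ENNReal.ofReal ε⁻¹ * powerLaw α y) (by fun_prop) (by fun_prop),
    ← lintegral_map (f := fun t => min 1 t) (g := (powerLaw α : EuclideanSpace ℝ (Fin d) → ℝ≥0∞))
      (by fun_prop) hm, ← smul_eq_mul, ← lintegral_smul_measure]
  congr 1
  ext A hA
  rw [Measure.map_apply (by fun_prop) hA, volume_preimage_const_mul_powerLaw hα (by positivity),
    Measure.smul_apply, Measure.map_apply hm hA, smul_eq_mul, Real.inv_rpow hε.le,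
    Real.rpow_neg hε.le]

/-- Up to `2 * r` the integrand is dominated by a multiple of the derivative of `(b - y ^ (-α)) ^ (1
- δ)`, a bounded function since `δ < 1`. Beyond `2 * r` the singular factor is bounded, and `y ^ (d
- 1 - α)` is integrable since `α > d`. -/
theorem integrableOn_powerLaw_singular {b : ℝ} (hb : 0 < b) (hd : 1 ≤ d) (hα : (d : ℝ) < α) :
    IntegrableOn (fun y : ℝ => y ^ (d - 1) * (y ^ (-α) * (b - y ^ (-α)) ^ (-(d / α))))
      (Ioi (b ^ (-α⁻¹))) := by
  have hd0 : (0 : ℝ) < d := by exact_mod_cast hd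
  have hα0 : 0 < α := hd0.trans hα
  set δ := (d : ℝ) / α with hδ
  have hδ1 : δ < 1 := (div_lt_one hα0).2 hα
  have hδ0 : 0 < δ := by positivity
  set r := b ^ (-α⁻¹) with hr
  have hr0 : 0 < r := by positivity
  have hrα : r ^ (-α) = b := by
    rw [hr, ← Real.rpow_mul hb.le]; simp [hα0.ne']
  have hpos : ∀ y, r < y → 0 < b - y ^ (-α) := fun y hy => by
    have := Real.rpow_lt_rpow_of_neg hr0 hy (neg_lt_zero.2 hα0)
    linarith
  have h1 : IntegrableOn (fun y : ℝ => (α * y ^ (-α - 1)) * (1 - δ) * (b - y ^ (-α)) ^ (1 - δ - 1))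
      (Ioi r) := by
    refine integrableOn_Ioi_deriv_of_nonneg (g := fun y => (b - y ^ (-α)) ^ (1 - δ))
      (l := (b - 0) ^ (1 - δ)) ?_ (fun y hy => ?_) (fun y hy => ?_) ?_
    · refine ContinuousAt.continuousWithinAt ?_
      refine ContinuousAt.rpow_const ?_ (.inr (by linarith))
      exact continuousAt_const.sub (Real.continuousAt_rpow_const _ _ (.inl hr0.ne'))
    · have hy0 : (0 : ℝ) < y := hr0.trans hy
      have := ((Real.hasDerivAt_rpow_const (x := y) (p := -α) (.inl hy0.ne')).const_sub b).rpow_const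
        (p := 1 - δ) (.inl (hpos y hy).ne')
      simpa using this
    · have hy0 : (0 : ℝ) < y := hr0.trans hy
      have := hpos y hy
      have : 0 < 1 - δ := by linarith
      positivity
    · refine Tendsto.rpow_const ?_ (.inr (by linarith))
      exact tendsto_const_nhds.sub (tendsto_rpow_neg_atTop hα0)
  have h2 : IntegrableOn (fun y : ℝ => y ^ (d - 1 - α)) (Ioi r) :=
    integrableOn_Ioi_rpow_of_lt (by linarith) hr0
  have hm : ContinuousOn (fun y : ℝ => y ^ (d - 1) * (y ^ (-α) * (b - y ^ (-α)) ^ (-δ)))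
      (Ioi r) := by
    intro y hy
    have hy0 : (0 : ℝ) < y := hr0.trans hy
    have h3 := Real.continuousAt_rpow_const y (-α) (.inl hy0.ne')
    exact ((continuousAt_id.pow _).mul (h3.mul ((continuousAt_const.sub h3).rpow_const
      (.inl (hpos y hy).ne')))).continuousWithinAt
  refine ((h1.const_mul ((2 * r) ^ (d : ℝ) / (α * (1 - δ)))).add
    (h2.const_mul ((b - (2 * r) ^ (-α)) ^ (-δ)))).mono' (hm.aestronglyMeasurable
      measurableSet_Ioi) ?_
  filter_upwards [ae_restrict_mem measurableSet_Ioi] with y hy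
  have hy0 : (0 : ℝ) < y := hr0.trans hy
  have hp := hpos y hy
  have hp2 := hpos (2 * r) (by linarith)
  have h1δ : 0 < 1 - δ := by linarith
  rw [Real.norm_of_nonneg (by positivity), Pi.add_apply]
  have e : y ^ (d - 1) * y ^ (-α) = y ^ ((d : ℝ) - 1 - α) := by
    rw [← Real.rpow_natCast, ← Real.rpow_add hy0, Nat.cast_sub hd]
    simp [sub_eq_add_neg]
  rw [← mul_assoc, e]
  rcases le_total y (2 * r) with h | h
  · refine le_add_of_le_of_nonneg ?_ (by positivity)
    have e1 : (2 * r) ^ (d : ℝ) / (α * (1 - δ)) *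
        (α * y ^ (-α - 1) * (1 - δ) * (b - y ^ (-α)) ^ (1 - δ - 1)) =
        (2 * r) ^ (d : ℝ) * y ^ (-α - 1) * (b - y ^ (-α)) ^ (-δ) := by
      rw [show 1 - δ - 1 = -δ by ring]
      field_simp
    rw [e1]
    have e2 : y ^ ((d : ℝ) - 1 - α) = y ^ (d : ℝ) * y ^ (-α - 1) := by
      rw [← Real.rpow_add hy0]; ring_nf
    rw [e2]
    gcongr
  · refine le_add_of_nonneg_of_le (by positivity) ?_
    rw [mul_comm]
    refine mul_le_mul_of_nonneg_right ?_ (by positivity)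
    refine Real.rpow_le_rpow_of_nonpos hp2 ?_ (by linarith)
    have := Real.rpow_le_rpow_of_nonpos (z := -α) (by linarith : 0 < 2 * r) h (by linarith)
    linarith

/-- By scaling, the integral over `y` is at most a constant times `f x * (b - f x) ^ (-(d / α))` for
`‖x‖ > r`, and it vanishes for `‖x‖ < r`. Polar coordinates reduce the rest to a one-dimensional
integral. -/
theorem lintegral_pairInteraction_powerLaw_ne_top {b : ℝ} (hb : 0 < b) (hd : 1 ≤ d)
    (hα : (d : ℝ) < α) :
    ∫⁻ x : EuclideanSpace ℝ (Fin d), ∫⁻ y : EuclideanSpace ℝ (Fin d),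
      pairInteraction (powerLaw α) (ENNReal.ofReal b) (x, y) ≠ ∞ := by
  classical
  have hd0 : (0 : ℝ) < d := by exact_mod_cast hd
  have hα0 : 0 < α := hd0.trans hα
  have : Nonempty (Fin d) := ⟨⟨0, hd⟩⟩
  set r := b ^ (-α⁻¹) with hr
  have hr0 : 0 < r := by positivity
  have hrα : r ^ (-α) = b := by
    rw [hr, ← Real.rpow_mul hb.le]; simp [hα0.ne']
  set w : ℝ → ℝ := (Ioi r).indicator fun y => y ^ (-α) * (b - y ^ (-α)) ^ (-(d / α)) with hw
  have hint : Integrable fun x : EuclideanSpace ℝ (Fin d) => w ‖x‖ := by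
    rw [integrable_fun_norm_addHaar, finrank_euclideanSpace_fin]
    have e : (fun y : ℝ => y ^ (d - 1) • w y) = (Ioi r).indicator fun y =>
        y ^ (d - 1) * (y ^ (-α) * (b - y ^ (-α)) ^ (-(d / α))) := by
      ext y
      by_cases hy : y ∈ Ioi r <;> simp [hw, hy]
    rw [e]
    exact ((integrableOn_powerLaw_singular hb hd hα).integrable_indicator
      measurableSet_Ioi).integrableOn
  set G := ∫⁻ y : EuclideanSpace ℝ (Fin d), min 1 (powerLaw α y) with hG
  have hGt : G < ∞ := lintegral_min_one_powerLaw_lt_top hα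
  have hbound : ∀ᵐ x : EuclideanSpace ℝ (Fin d),
      ∫⁻ y, pairInteraction (powerLaw α) (ENNReal.ofReal b) (x, y) ≤
        ENNReal.ofReal (w ‖x‖) * (G / ENNReal.ofReal b) := by
    -- On this sphere `b - f x = 0` and the bound breaks down, but the sphere is null.
    have hs : ∀ᵐ x : EuclideanSpace ℝ (Fin d), x ∉ Metric.sphere 0 r :=
      measure_eq_zero_iff_ae_notMem.1 (Measure.addHaar_sphere _ _ _)
    filter_upwards [hs] with x hx
    rcases lt_trichotomy ‖x‖ r with h | h | h
    · have := (lt_powerLaw_iff hα0 hb x).2 h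
      simp [pairInteraction, this]
    · exact absurd (mem_sphere_zero_iff_norm.2 h) hx
    · have hx0 : x ≠ 0 := norm_pos_iff.1 (hr0.trans h)
      have hlt : ‖x‖ ^ (-α) < b := by
        have := Real.rpow_lt_rpow_of_neg hr0 h (neg_lt_zero.2 hα0)
        rwa [hrα] at this
      have hx1 := powerLaw_eq_ofReal (α := α) hx0
      calc ∫⁻ y, pairInteraction (powerLaw α) (ENNReal.ofReal b) (x, y)
          ≤ ∫⁻ y : EuclideanSpace ℝ (Fin d), powerLaw α x / ENNReal.ofReal b *
            min 1 (powerLaw α y / ENNReal.ofReal (b - ‖x‖ ^ (-α))) := by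
            refine lintegral_mono fun y => ?_
            unfold pairInteraction
            split_ifs
            · exact zero_le
            · rw [hx1, ENNReal.ofReal_sub _ (by positivity)]
        _ = ENNReal.ofReal (w ‖x‖) * (G / ENNReal.ofReal b) := by
            rw [lintegral_const_mul' _ _ (ENNReal.div_ne_top (by simp [hx1]) (by simpa)),
              lintegral_min_one_powerLaw_div hα0 (by linarith), hx1, hw,
              indicator_of_mem (show ‖x‖ ∈ Ioi r from h), ENNReal.ofReal_mul (by positivity)]
            simp only [div_eq_mul_inv, ← hG]
            ring
  refine ((lintegral_mono_ae hbound).trans_lt ?_).ne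
  rw [lintegral_mul_const' _ _ (ENNReal.div_ne_top hGt.ne (by simpa))]
  refine ENNReal.mul_lt_top ?_ (ENNReal.div_lt_top hGt.ne (by simpa))
  exact hint.lintegral_lt_top

end Volume

/-! ### Stable convolution semigroups on `[0, ∞]` -/

theorem tendsto_measure_Ioi {ν : Measure ℝ≥0∞} [IsFiniteMeasure ν] {t : ℝ≥0∞} (ht : ν {t} = 0) :
    Tendsto (fun s => ν (Ioi s)) (𝓝 t) (𝓝 (ν (Ioi t))) := by
  refine tendsto_measure_of_ae_tendsto_indicator_of_isFiniteMeasure (𝓝 t) measurableSet_Ioi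
    (fun s => measurableSet_Ioi) ?_
  filter_upwards [measure_eq_zero_iff_ae_notMem.1 ht] with x hx
  rcases lt_or_gt_of_ne (show x ≠ t from hx) with h | h
  · filter_upwards [lt_mem_nhds h] with s hs
    simp [h.not_gt, hs.not_gt]
  · filter_upwards [gt_mem_nhds h] with s hs
    simp [h, hs]

theorem lintegral_conv_apply {ν ρ : Measure ℝ≥0∞} [SFinite ρ] {A : Set ℝ≥0∞}
    (hA : MeasurableSet A) : (ν ∗ ρ) A = ∫⁻ x, ρ {y | x + y ∈ A} ∂ν := by
  rw [← lintegral_indicator_one hA, Measure.lintegral_conv (measurable_one.indicator hA)]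
  refine lintegral_congr fun x => ?_
  exact lintegral_indicator_one ((measurable_const_add x) hA)

theorem exists_max_atom (ν : Measure ℝ≥0∞) [IsFiniteMeasure ν] {a₀ : ℝ≥0∞} (h : ν {a₀} ≠ 0) :
    ∃ a, ν {a} ≠ 0 ∧ ∀ s, ν {s} ≤ ν {a} := by
  have hf : {s | ν {a₀} ≤ ν {s}}.Finite :=
    Measure.finite_const_le_meas_of_disjoint_iUnion ν (pos_iff_ne_zero.2 h)
      (fun s => measurableSet_singleton s) (fun i j hij => by simpa using hij)
      (measure_ne_top _ _)
  obtain ⟨a, ha, hmax⟩ := Set.exists_max_image _ (fun s => ν {s}) hf ⟨a₀, show ν {a₀} ≤ ν {a₀} from le_rfl⟩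
  refine ⟨a, fun h0 => h (le_antisymm (h0 ▸ ha) zero_le), fun s => ?_⟩
  rcases le_total (ν {a₀}) (ν {s}) with h1 | h1
  · exact hmax s h1
  · exact h1.trans ha

/-- A measure all of whose atoms are finite has no atoms if it is unbounded and its self-convolution
is a multiple of it. -/
theorem measure_singleton_eq_zero_of_conv_self {ν : Measure ℝ≥0∞} [IsProbabilityMeasure ν]
    {c : ℝ≥0} (hc : c ≠ 0) (h : ν ∗ ν = ν.map fun x : ℝ≥0∞ => c * x) (htop : ν {∞} = 0)
    (hpos : ∀ t ≠ ∞, ν (Ioi t) ≠ 0) (s : ℝ≥0∞) : ν {s} = 0 := by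
  by_contra hs
  obtain ⟨a, ha, hmax⟩ := exists_max_atom ν hs
  have hat : a ≠ ∞ := by rintro rfl; exact ha htop
  have hct : (c : ℝ≥0∞) * a ≠ ∞ := ENNReal.mul_ne_top ENNReal.coe_ne_top hat
  -- Dilation carries the largest atom `a` to an atom of `ν ∗ ν` of the same mass. Convolution
  -- averages atoms of mass at most `ν {a}`, and only `x ≤ c * a` contribute, so `ν` would have to
  -- be carried by `[0, c * a]`.
  have h1 : (ν ∗ ν) {(c : ℝ≥0∞) * a} = ν {a} := by
    rw [h, Measure.map_apply (measurable_const_mul _) (measurableSet_singleton _)]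
    congr 1
    ext x
    simp [ENNReal.mul_right_inj, hc]
  have h2 : ν {a} ≤ ν {a} * ν (Iic (c * a)) := by
    calc ν {a} = ∫⁻ x, ν {y | x + y ∈ ({(c : ℝ≥0∞) * a} : Set ℝ≥0∞)} ∂ν := by
          rw [← h1, lintegral_conv_apply (measurableSet_singleton _)]
      _ ≤ ∫⁻ x, (Iic ((c : ℝ≥0∞) * a)).indicator (fun _ => ν {a}) x ∂ν := by
          refine lintegral_mono fun x => ?_
          by_cases hx : x ≤ c * a
          · rw [indicator_of_mem (show x ∈ Iic ((c : ℝ≥0∞) * a) from hx)]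
            refine (measure_mono fun y hy => ?_).trans (hmax (c * a - x))
            exact ENNReal.eq_sub_of_add_eq (ne_top_of_le_ne_top hct hx) (by rwa [add_comm])
          · rw [show {y | x + y ∈ ({(c : ℝ≥0∞) * a} : Set ℝ≥0∞)} = ∅ from
              eq_empty_of_forall_notMem fun y hy => hx (le_self_add.trans_eq hy), measure_empty]
            exact zero_le
      _ = ν {a} * ν (Iic (c * a)) := by
          rw [lintegral_indicator_const measurableSet_Iic]
  have h3 : 1 ≤ ν (Iic ((c : ℝ≥0∞) * a)) := by
    by_contra hlt
    push Not at hlt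
    have := ENNReal.mul_lt_mul_right ha (measure_ne_top _ _) hlt
    rw [mul_one] at this
    exact absurd h2 this.not_ge
  refine hpos _ hct ?_
  rw [← compl_Iic, prob_compl_eq_zero_iff measurableSet_Iic]
  exact le_antisymm prob_le_one h3

/-- A convolution semigroup of probability measures on `[0, ∞]` that is stable of index `δ < 1`,
whose probabilities of exceeding `b` are `1 - exp (-C l) + O(l ^ 2)`. -/
structure IsStableSemigroup (ν : ℝ≥0 → Measure ℝ≥0∞) (δ : ℝ) (b : ℝ≥0) (C K : ℝ) : Prop where
  isProbabilityMeasure : ∀ l, IsProbabilityMeasure (ν l)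
  pos : 0 < δ
  lt_one : δ < 1
  b_ne_zero : b ≠ 0
  C_pos : 0 < C
  conv : ∀ l h, ν (l + h) = ν l ∗ ν h
  scale : ∀ c : ℝ≥0, c ≠ 0 → ∀ l, ν (c ^ δ * l) = (ν l).map fun x : ℝ≥0∞ => c * x
  lower : ∀ l : ℝ≥0, 1 - Real.exp (-(C * l)) ≤ (ν l).real (Ioi b)
  upper : ∀ l : ℝ≥0, (ν l).real (Ioi b) ≤ 1 - Real.exp (-(C * l)) + K * l ^ 2

namespace IsStableSemigroup

variable {ν : ℝ≥0 → Measure ℝ≥0∞} {δ : ℝ} {b : ℝ≥0} {C K : ℝ}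

theorem tail_zero (H : IsStableSemigroup ν δ b C K) : (ν 0).real (Ioi b) = 0 := by
  have h2 := H.upper 0
  simp at h2
  exact le_antisymm (by simpa using h2) measureReal_nonneg

theorem tendsto_tail_zero (H : IsStableSemigroup ν δ b C K) :
    Tendsto (fun l => (ν l).real (Ioi b)) (𝓝 0) (𝓝 0) := by
  have hc : Continuous fun l : ℝ≥0 => 1 - Real.exp (-(C * l)) := by fun_prop
  have hc' : Continuous fun l : ℝ≥0 => 1 - Real.exp (-(C * l)) + K * (l : ℝ) ^ 2 := by fun_prop
  have h1 := hc.tendsto 0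
  have h2 := hc'.tendsto 0
  simp only [NNReal.coe_zero, mul_zero, neg_zero, Real.exp_zero, sub_self, ne_eq,
    OfNat.ofNat_ne_zero, not_false_eq_true, zero_pow, add_zero] at h1 h2
  exact tendsto_of_tendsto_of_tendsto_of_le_of_le h1 h2 H.lower H.upper

theorem measure_Ioi (H : IsStableSemigroup ν δ b C K) {c : ℝ≥0} (hc : c ≠ 0) (l : ℝ≥0) :
    ν (c ^ δ * l) (Ioi b) = ν l (Ioi (b / c : ℝ≥0)) := by
  rw [H.scale c hc, Measure.map_apply (measurable_const_mul _) measurableSet_Ioi]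
  congr 1
  ext x
  rw [mem_preimage, mem_Ioi, mem_Ioi, ENNReal.coe_div hc,
    ENNReal.div_lt_iff (.inl (by simpa)) (.inl (by simp)), mul_comm]

/-- Dilation moves the threshold `b` to `t + 1`, and the lower bound is positive at every positive
intensity. The `+ 1` keeps the divisor nonzero. -/
theorem measure_Ioi_ne_zero (H : IsStableSemigroup ν δ b C K) {l : ℝ≥0} (hl : l ≠ 0)
    {t : ℝ≥0∞} (ht : t ≠ ∞) : ν l (Ioi t) ≠ 0 := by
  lift t to ℝ≥0 using ht
  have hc : b / (t + 1) ≠ 0 := div_ne_zero H.b_ne_zero (by positivity)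
  have h1 := H.measure_Ioi hc l
  rw [div_div_cancel₀ H.b_ne_zero] at h1
  have h2 := H.lower ((b / (t + 1)) ^ δ * l)
  have h3 : 0 < C * (((b / (t + 1)) ^ δ * l : ℝ≥0) : ℝ) := by
    have := H.C_pos
    have : 0 < (b / (t + 1)) ^ δ * l := by positivity
    positivity
  have h4 : Real.exp (-(C * (((b / (t + 1)) ^ δ * l : ℝ≥0) : ℝ))) < 1 := by
    rw [Real.exp_lt_one_iff]; linarith
  have h5 := H.isProbabilityMeasure ((b / (t + 1)) ^ δ * l)
  have h6 : ν ((b / (t + 1)) ^ δ * l) (Ioi b) ≠ 0 := fun h0 => by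
    rw [measureReal_def, h0, ENNReal.toReal_zero] at h2
    linarith
  rw [h1] at h6
  refine fun h0 => h6 (measure_mono_null (Ioi_subset_Ioi ?_) h0)
  push_cast
  exact le_self_add

/-- Dilations fix `∞`, so its mass is at most the tail at arbitrarily small intensity, which tends
to `0`. -/
theorem measure_top (H : IsStableSemigroup ν δ b C K) (l : ℝ≥0) : ν l {∞} = 0 := by
  have h := H.isProbabilityMeasure
  have h1 : ∀ n : ℕ, (ν l).real {∞} ≤ (ν ((1 / (n + 1)) ^ δ * l)).real (Ioi b) := fun n => by
    have hc : (1 / ((n : ℝ≥0) + 1)) ≠ 0 := by positivity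
    rw [measureReal_def, measureReal_def, H.measure_Ioi hc]
    exact ENNReal.toReal_mono (measure_ne_top _ _) (measure_mono
      (singleton_subset_iff.2 ENNReal.coe_lt_top))
  have h2 : Tendsto (fun n : ℕ => ((1 / ((n : ℝ≥0) + 1)) ^ δ * l)) atTop (𝓝 0) := by
    have h3 : Tendsto (fun n : ℕ => 1 / ((n : ℝ≥0) + 1)) atTop (𝓝 0) :=
      tendsto_one_div_add_atTop_nhds_zero_nat
    have := (((NNReal.continuousAt_rpow_const (.inr H.pos.le)).tendsto.comp h3)).mul_const l
    simpa [NNReal.zero_rpow H.pos.ne'] using this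
  have h3 := ge_of_tendsto' (H.tendsto_tail_zero.comp h2) h1
  have h4 : (ν l).real {∞} = 0 := le_antisymm h3 measureReal_nonneg
  exact (measureReal_eq_zero_iff).1 h4

theorem measure_singleton (H : IsStableSemigroup ν δ b C K) (s : ℝ≥0∞) : ν 1 {s} = 0 := by
  have h := H.isProbabilityMeasure
  -- With this factor `c ^ δ = 2`, so the dilated law is `ν 2 = ν 1 ∗ ν 1`.
  have hc : (2 : ℝ≥0) ^ δ⁻¹ ≠ 0 := by positivity
  refine measure_singleton_eq_zero_of_conv_self hc ?_ (H.measure_top 1)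
    (fun t ht => H.measure_Ioi_ne_zero one_ne_zero ht) s
  rw [← H.conv, ← H.scale _ hc, ← NNReal.rpow_mul, inv_mul_cancel₀ H.pos.ne', NNReal.rpow_one, mul_one]
  norm_num

/-- For `m ≠ 0` scaling trades the intensity for the threshold `b / m ^ (1/δ)` under `ν 1`, which
has no atoms. At `0` the two bounds decide. -/
theorem continuous_tail (H : IsStableSemigroup ν δ b C K) :
    Continuous fun l => (ν l).real (Ioi b) := by
  have h := H.isProbabilityMeasure
  refine continuous_iff_continuousAt.2 fun l => ?_
  by_cases hl : l = 0
  · subst hl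
    rw [ContinuousAt, H.tail_zero]
    exact H.tendsto_tail_zero
  have e : ∀ m : ℝ≥0, m ≠ 0 → (ν m).real (Ioi b) =
      (ν 1 (Ioi ((b / m ^ δ⁻¹ : ℝ≥0) : ℝ≥0∞))).toReal := fun m hm => by
    have hc : m ^ δ⁻¹ ≠ 0 := by positivity
    rw [← H.measure_Ioi hc, ← NNReal.rpow_mul, inv_mul_cancel₀ H.pos.ne', NNReal.rpow_one, mul_one, measureReal_def]
  have h1 : ContinuousAt (fun m : ℝ≥0 => (ν 1 (Ioi ((b / m ^ δ⁻¹ : ℝ≥0) : ℝ≥0∞))).toReal) l := by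
    have hc : l ^ δ⁻¹ ≠ 0 := by positivity
    have h2 : ContinuousAt (fun m : ℝ≥0 => ((b / m ^ δ⁻¹ : ℝ≥0) : ℝ≥0∞)) l :=
      ENNReal.continuous_coe.continuousAt.comp
        (continuousAt_const.div (NNReal.continuousAt_rpow_const (.inl hl)) hc)
    exact (ENNReal.tendsto_toReal (measure_ne_top _ _)).comp
      ((tendsto_measure_Ioi (H.measure_singleton _)).comp h2)
  refine h1.congr ?_
  filter_upwards [isOpen_ne.mem_nhds hl] with m hm
  exact (e m hm).symm

theorem measure_Iic (H : IsStableSemigroup ν δ b C K) {c : ℝ≥0} (hc : c ≠ 0) (l : ℝ≥0) :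
    ν (c ^ δ * l) (Iic b) = ν l (Iic (b / c : ℝ≥0)) := by
  rw [H.scale c hc, Measure.map_apply (measurable_const_mul _) measurableSet_Iic]
  congr 1
  ext x
  rw [mem_preimage, mem_Iic, mem_Iic, ENNReal.coe_div hc,
    ENNReal.le_div_iff_mul_le (.inl (by simpa)) (.inl (by simp)), mul_comm]

/-- Two independent halves, each at most `b / 2`, have sum at most `b`. Rescaling `b / 2` to `b`
turns the intensity `l / 2` into `2 ^ (δ - 1) * l`, which is smaller than `l` for `l ≠ 0`. -/
theorem measure_Iic_sq_le (H : IsStableSemigroup ν δ b C K) (l : ℝ≥0) :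
    ν (2 ^ (δ - 1) * l) (Iic b) ^ 2 ≤ ν l (Iic b) := by
  have h := H.isProbabilityMeasure
  have e1 : (2 : ℝ≥0) ^ (δ - 1) * l = 2 ^ δ * (l / 2) := by
    rw [NNReal.rpow_sub_one two_ne_zero]
    ring
  rw [e1, H.measure_Iic two_ne_zero, sq, ← Measure.prod_prod]
  conv_rhs => rw [← add_halves l, H.conv, Measure.conv,
    Measure.map_apply measurable_add measurableSet_Iic]
  refine measure_mono fun x hx => ?_
  have h2 : x.1 + x.2 ≤ ((b / 2 : ℝ≥0) : ℝ≥0∞) + ((b / 2 : ℝ≥0) : ℝ≥0∞) := add_le_add hx.1 hx.2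
  rwa [← ENNReal.coe_add, add_halves] at h2

theorem measure_Iic_add_le (H : IsStableSemigroup ν δ b C K) (l m : ℝ≥0) :
    ν (l + m) (Iic b) ≤ ν l (Iic b) * ν m (Iic b) := by
  have h := H.isProbabilityMeasure
  rw [← Measure.prod_prod, H.conv, Measure.conv, Measure.map_apply measurable_add measurableSet_Iic]
  exact measure_mono fun x (hx : x.1 + x.2 ≤ b) =>
    ⟨(le_self_add : x.1 ≤ x.1 + x.2).trans hx, (le_add_self : x.2 ≤ x.1 + x.2).trans hx⟩

theorem tail_eq (H : IsStableSemigroup ν δ b C K) (l : ℝ≥0) :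
    (ν l).real (Ioi b) = 1 - (ν l).real (Iic b) := by
  have h := H.isProbabilityMeasure
  rw [← compl_Iic, probReal_compl_eq_one_sub measurableSet_Iic]

theorem measure_Iic_ne_zero (H : IsStableSemigroup ν δ b C K) (l : ℝ≥0) : ν l (Iic b) ≠ 0 := by
  intro h0
  -- A zero would propagate to intensities tending to `0`, where the tail tends to `0`, not `1`.
  have h1 : ∀ n : ℕ, ν ((2 ^ (δ - 1)) ^ n * l) (Iic b) = 0 := fun n => by
    induction n with
    | zero => simpa using h0
    | succ n ih =>
      have := H.measure_Iic_sq_le ((2 ^ (δ - 1)) ^ n * l)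
      rw [ih, ← mul_assoc, ← pow_succ'] at this
      exact pow_eq_zero_iff two_ne_zero |>.1 (le_antisymm this zero_le)
  have h2 : Tendsto (fun n : ℕ => ((2 : ℝ≥0) ^ (δ - 1)) ^ n * l) atTop (𝓝 0) := by
    have h3 : (2 : ℝ≥0) ^ (δ - 1) < 1 :=
      NNReal.rpow_lt_one_of_one_lt_of_neg one_lt_two (by linarith [H.lt_one])
    simpa using (NNReal.tendsto_pow_atTop_nhds_zero_of_lt_one h3).mul_const l
  have h3 := H.tendsto_tail_zero.comp h2
  have h4 : ((fun l => (ν l).real (Ioi b)) ∘ fun n : ℕ => ((2 : ℝ≥0) ^ (δ - 1)) ^ n * l) =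
      fun _ => 1 := by
    ext n
    simp [H.tail_eq, measureReal_def, h1]
  rw [h4] at h3
  exact one_ne_zero (tendsto_nhds_unique tendsto_const_nhds h3)

theorem tail_lt_one (H : IsStableSemigroup ν δ b C K) (l : ℝ≥0) : (ν l).real (Ioi b) < 1 := by
  have h := H.isProbabilityMeasure
  rw [H.tail_eq]
  have : 0 < (ν l).real (Iic b) :=
    ENNReal.toReal_pos (H.measure_Iic_ne_zero l) (measure_ne_top _ _)
  linarith

/-- A sum at most `b` has both parts at most `b`, so adding intensity `k` multiplies the positive
mass of `[0, b]` by at most `ν k [0, b] < 1`. -/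
theorem strictMono_tail (H : IsStableSemigroup ν δ b C K) :
    StrictMono fun l => (ν l).real (Ioi b) := by
  have h := H.isProbabilityMeasure
  intro l m hlm
  obtain ⟨k, rfl⟩ := exists_add_of_le hlm.le
  have hk : k ≠ 0 := by rintro rfl; simp at hlm
  have h1 := ENNReal.toReal_mono (ENNReal.mul_ne_top (measure_ne_top _ _) (measure_ne_top _ _))
    (H.measure_Iic_add_le l k)
  rw [ENNReal.toReal_mul] at h1
  have h2 : 0 < (ν l).real (Iic b) :=
    ENNReal.toReal_pos (H.measure_Iic_ne_zero l) (measure_ne_top _ _)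
  have h3 : 0 < (ν k).real (Ioi b) :=
    ENNReal.toReal_pos (H.measure_Ioi_ne_zero hk ENNReal.coe_ne_top) (measure_ne_top _ _)
  rw [H.tail_eq] at h3
  simp only [H.tail_eq]
  simp only [← measureReal_def] at h1
  nlinarith

theorem bijOn_tail (H : IsStableSemigroup ν δ b C K) :
    BijOn (fun l => (ν l).real (Ioi b)) univ (Ico 0 1) := by
  have h := H.isProbabilityMeasure
  refine ⟨fun l _ => ⟨measureReal_nonneg, H.tail_lt_one l⟩, H.strictMono_tail.injective.injOn,
    fun y hy => ?_⟩
  obtain ⟨L, hL⟩ : ∃ L : ℝ≥0, y < 1 - Real.exp (-(C * L)) := by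
    have h2 : Tendsto (fun L : ℝ≥0 => 1 - Real.exp (-(C * L))) atTop (𝓝 (1 - 0)) :=
      tendsto_const_nhds.sub (Real.tendsto_exp_neg_atTop_nhds_zero.comp
        ((NNReal.tendsto_coe_atTop.2 tendsto_id).const_mul_atTop H.C_pos))
    exact (h2.eventually (lt_mem_nhds (by simpa using hy.2))).exists
  have h1 := intermediate_value_Icc (zero_le (a := L)) H.continuous_tail.continuousOn
  rw [H.tail_zero] at h1
  obtain ⟨l, -, hl⟩ := h1 ⟨hy.1, (hL.trans_le (H.lower L)).le⟩
  exact ⟨l, mem_univ _, hl⟩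

end IsStableSemigroup

/-! ### Expansions from the exponential bounds -/

theorem transmissionCapacity_isBigO {q : ℝ≥0 → ℝ} {C K : ℝ} (hC : 0 < C) (hK : 0 ≤ K)
    (hq : BijOn q univ (Ico 0 1)) (hl : ∀ l : ℝ≥0, 1 - Real.exp (-(C * l)) ≤ q l)
    (hu : ∀ l : ℝ≥0, q l ≤ 1 - Real.exp (-(C * l)) + K * l ^ 2) :
    (fun x : ℝ => transmissionCapacity q x - x / C) =O[𝓝[≥] 0] fun x : ℝ => x ^ 2 := by
  -- For `s = C * m` and `x ≤ 1 / 2` the lower bound gives `s * (1 - x) ≤ x`, hence `s ≤ 2 * x`. In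
  -- `x ≤ s + K * m ^ 2` this turns the errors `K * m ^ 2` and `s * x` into `4 * K / C ^ 2 * x ^ 2`
  -- and `2 * x ^ 2`.
  refine IsBigO.of_bound ((4 * K / C ^ 2 + 2) / C) ?_
  have h2 : ∀ᶠ x : ℝ in 𝓝[≥] 0, x ∈ Icc (0 : ℝ) (1 / 2) := Icc_mem_nhdsGE (by norm_num)
  filter_upwards [h2] with x hx
  obtain ⟨l, -, hlx⟩ := hq.surjOn ⟨hx.1, by linarith [hx.2]⟩
  rw [transmissionCapacity]
  have he : q (Function.invFun q x) = x := Function.invFun_eq ⟨l, hlx⟩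
  generalize Function.invFun q x = m at he
  have h3 := hl m
  have h4 := hu m
  rw [he] at h3 h4
  set s := C * (m : ℝ) with hs
  have hs0 : 0 ≤ s := by positivity
  have h5 : s + 1 ≤ Real.exp s := Real.add_one_le_exp s
  have h6 : -s + 1 ≤ Real.exp (-s) := Real.add_one_le_exp (-s)
  have h7 : Real.exp s * Real.exp (-s) = 1 := by rw [← Real.exp_add]; simp
  have h8 : (s + 1) * (1 - x) ≤ 1 := by
    refine le_of_le_of_eq ?_ h7
    exact mul_le_mul h5 (by linarith) (by linarith [hx.2]) (by positivity)
  have h9 : s * (1 - x) ≤ x := by linarith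
  have h10 : s ≤ 2 * x := by nlinarith [hx.1, hx.2]
  have hm : (m : ℝ) = s / C := by rw [hs]; field_simp
  have h11 : (m : ℝ) ^ 2 ≤ 4 * x ^ 2 / C ^ 2 := by
    rw [hm, div_pow]
    gcongr
    nlinarith [hx.1]
  have h12 : x - K * (4 * x ^ 2 / C ^ 2) - 2 * x ^ 2 ≤ s * (1 - x) := by
    have := mul_le_mul_of_nonneg_left h11 hK
    nlinarith [hx.1, mul_le_mul_of_nonneg_right h10 hx.1]
  have e : (m : ℝ) * (1 - x) - x / C = (s * (1 - x) - x) / C := by rw [hm]; ring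
  have h13 : |s * (1 - x) - x| ≤ (4 * K / C ^ 2 + 2) * x ^ 2 := by
    rw [abs_le]
    have : K * (4 * x ^ 2 / C ^ 2) = 4 * K / C ^ 2 * x ^ 2 := by ring
    constructor
    · nlinarith
    · have : 0 ≤ (4 * K / C ^ 2 + 2) * x ^ 2 := by positivity
      linarith
  rw [e, Real.norm_eq_abs, abs_div, abs_of_pos hC, Real.norm_of_nonneg (by positivity),
    div_mul_eq_mul_div]
  gcongr

theorem isBigO_sub_of_exp_bounds {q : ℝ≥0 → ℝ} {C K : ℝ} (hC : 0 < C) (hK : 0 ≤ K)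
    (hl : ∀ l : ℝ≥0, 1 - Real.exp (-(C * l)) ≤ q l)
    (hu : ∀ l : ℝ≥0, q l ≤ 1 - Real.exp (-(C * l)) + K * l ^ 2) :
    (fun l : ℝ≥0 => q l - C * l) =O[𝓝 0] fun l : ℝ≥0 => (l : ℝ) ^ 2 := by
  refine IsBigO.of_bound (C ^ 2 + K) (Eventually.of_forall fun l => ?_)
  have h1 := hl l
  have h2 := hu l
  set s := C * (l : ℝ) with hs
  have hs0 : 0 ≤ s := by positivity
  have h5 : s + 1 ≤ Real.exp s := Real.add_one_le_exp s
  have h6 : -s + 1 ≤ Real.exp (-s) := Real.add_one_le_exp (-s)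
  have h7 : Real.exp s * Real.exp (-s) = 1 := by rw [← Real.exp_add]; simp
  have h8 : Real.exp (-s) ≤ 1 - s + s ^ 2 := by
    have : (s + 1) * Real.exp (-s) ≤ 1 := by
      refine le_of_le_of_eq ?_ h7
      gcongr
    -- The product equals `1 + s ^ 3`.
    have h9 : 1 ≤ (s + 1) * (1 - s + s ^ 2) := by
      have : 0 ≤ s ^ 3 := by positivity
      nlinarith
    exact le_of_mul_le_mul_left (this.trans h9) (by linarith)
  rw [Real.norm_of_nonneg (sq_nonneg (l : ℝ)), Real.norm_eq_abs, abs_le]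
  have e : (C ^ 2 + K) * (l : ℝ) ^ 2 = s ^ 2 + K * (l : ℝ) ^ 2 := by rw [hs]; ring
  have : 0 ≤ K * (l : ℝ) ^ 2 := by positivity
  rw [e]
  constructor <;> nlinarith [sq_nonneg s]

/-! ### The interference of a Poisson point process -/

theorem interference_eq {d : ℕ} (α P : ℝ) (X : Set (EuclideanSpace ℝ (Fin d))) :
    interference α 0 P X = ENNReal.ofReal P * shotNoise (powerLaw α) X := by
  rw [interference, ENNReal.tsum_mul_left, shotNoise, lintegral_pointMeasure _ measurable_powerLaw]
  simp [pathLoss, powerLaw]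

theorem sinr_lt_iff {d : ℕ} {α P N u τ : ℝ} (hP : 0 < P) (hN : 0 ≤ N) (hu : 0 < u) (hτ : 0 < τ)
    (hb : 0 ≤ u ^ (-α) / τ - N / P) (X : Set (EuclideanSpace ℝ (Fin d))) :
    sinr α 0 P N u X < ENNReal.ofReal τ ↔
      ENNReal.ofReal (u ^ (-α) / τ - N / P) < shotNoise (powerLaw α) X := by
  have hS : 0 < P * u ^ (-α) := by positivity
  rw [sinr, interference_eq, pathLoss, if_pos hu.le, ENNReal.ofReal_rpow_of_pos hu,
    ← ENNReal.ofReal_mul hP.le, ENNReal.div_lt_iff (.inr (by simpa)) (.inr ENNReal.ofReal_ne_top)]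
  -- Infinite interference is always an outage; otherwise both sides become inequalities between
  -- real numbers.
  rcases eq_or_ne (shotNoise (powerLaw α) X) ∞ with h | h
  · simp [h, ENNReal.mul_top, hP, hτ]
  · lift shotNoise (powerLaw α) X to ℝ≥0 using h with j
    rw [← ENNReal.ofReal_coe_nnreal, ← ENNReal.ofReal_mul hP.le,
      ← ENNReal.ofReal_add (by positivity) hN, ← ENNReal.ofReal_mul hτ.le,
      ENNReal.ofReal_lt_ofReal_iff_of_nonneg hS.le, ENNReal.ofReal_lt_ofReal_iff_of_nonneg hb,
      sub_lt_iff_lt_add, div_lt_iff₀ hτ, ← mul_lt_mul_iff_right₀ hP (b := u ^ (-α))]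
    have e : P * ((j + N / P) * τ) = τ * (P * j + N) := by field_simp
    rw [e]

theorem map_shotNoise_add {d : ℕ} {α : ℝ} (hα : 0 < α) {Ω : ℝ≥0 → Type*}
    [∀ l, MeasurableSpace (Ω l)] {μ : ∀ l, Measure (Ω l)} [∀ l, IsProbabilityMeasure (μ l)]
    {X : ∀ l, Ω l → Set (EuclideanSpace ℝ (Fin d))}
    (hX : ∀ l, IsPoissonPointProcess (μ l) l (X l)) (l h : ℝ≥0) :
    (μ (l + h)).map (fun ω => shotNoise (powerLaw α) (X (l + h) ω)) =
      (μ l).map (fun ω => shotNoise (powerLaw α) (X l ω)) ∗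
        (μ h).map (fun ω => shotNoise (powerLaw α) (X h ω)) :=
  map_shotNoise_eq_conv (hX _) (hX _) (hX _) measurable_powerLaw measurable_powerLaw
    measurable_powerLaw (fun _ => isBounded_le_powerLaw hα) (fun _ => isBounded_le_powerLaw hα)
    (fun _ => isBounded_le_powerLaw hα) fun A _ => by rw [ENNReal.coe_add, add_mul]

theorem map_shotNoise_mul {d : ℕ} {α : ℝ} (hα : 0 < α) {Ω : ℝ≥0 → Type*}
    [∀ l, MeasurableSpace (Ω l)] {μ : ∀ l, Measure (Ω l)} [∀ l, IsProbabilityMeasure (μ l)]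
    {X : ∀ l, Ω l → Set (EuclideanSpace ℝ (Fin d))}
    (hX : ∀ l, IsPoissonPointProcess (μ l) l (X l)) {c : ℝ≥0} (hc : c ≠ 0) (l : ℝ≥0) :
    (μ (c ^ (d / α) * l)).map (fun ω => shotNoise (powerLaw α) (X (c ^ (d / α) * l) ω)) =
      ((μ l).map (fun ω => shotNoise (powerLaw α) (X l ω))).map fun x : ℝ≥0∞ => c * x := by
  have hm : Measurable (powerLaw α : EuclideanSpace ℝ (Fin d) → ℝ≥0∞) := measurable_powerLaw
  have hb : ∀ a ≠ 0, Bornology.IsBounded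
      {x : EuclideanSpace ℝ (Fin d) | a ≤ (c : ℝ≥0∞) * powerLaw α x} := fun a ha => by
    have h := isBounded_le_powerLaw (E := EuclideanSpace ℝ (Fin d)) hα
      (a := a / c) (ENNReal.div_ne_zero.2 ⟨ha, ENNReal.coe_ne_top⟩)
    refine h.subset fun x hx => ENNReal.div_le_of_le_mul ?_
    rwa [mul_comm]
  -- Superposition with a vanishing second response is plain equality in law, here between an
  -- amplified response and a denser process.
  have key := map_shotNoise_eq_conv (hX (c ^ (d / α) * l)) (hX l) (hX 0) hm (hm.const_mul c)
    measurable_zero (fun _ => isBounded_le_powerLaw hα) hb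
    (fun a ha => by simp [ha, Bornology.isBounded_empty]) fun A _ => by
      have := volume_preimage_const_mul_powerLaw (d := d) hα (c := c) (by positivity) A
      rw [ENNReal.ofReal_coe_nnreal] at this
      rw [this, ← NNReal.coe_rpow, ENNReal.ofReal_coe_nnreal]
      simp only [ENNReal.coe_mul, ENNReal.coe_zero, zero_mul, add_zero]
      ring
  have h0 : (fun ω => shotNoise (0 : EuclideanSpace ℝ (Fin d) → ℝ≥0∞) (X 0 ω)) = 0 := by
    ext ω; simp [shotNoise]
  have h1 : (fun ω => shotNoise (fun x => c * powerLaw α x) (X l ω)) =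
      (fun x : ℝ≥0∞ => c * x) ∘ fun ω => shotNoise (powerLaw α) (X l ω) := by
    ext ω
    exact lintegral_const_mul _ hm
  rw [key, h0, map_zero_eq_dirac, Measure.conv_dirac_zero, h1,
    Measure.map_map (measurable_const_mul _) ((hX l).measurable_shotNoise hm)]

/-! ### Exponential bounds for the outage probability -/

section Bounds

variable {d : ℕ} {α b : ℝ} {Ω : Type*} [MeasurableSpace Ω] {μ : Measure Ω}
  [IsProbabilityMeasure μ] {l : ℝ≥0} {X : Ω → Set (EuclideanSpace ℝ (Fin d))}

theorem volume_real_ball_rpow (hd : 1 ≤ d) (hb : 0 < b) :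
    volume.real (Metric.ball (0 : EuclideanSpace ℝ (Fin d)) (b ^ (-α⁻¹))) =
      unitBallVolume d / b ^ (d / α) := by
  have : Nonempty (Fin d) := ⟨⟨0, hd⟩⟩
  rw [measureReal_def, Measure.addHaar_ball _ _ (by positivity), finrank_euclideanSpace_fin,
    ← Measure.addHaar_closedBall_eq_addHaar_ball, ENNReal.toReal_mul,
    ENNReal.toReal_ofReal (by positivity), ← Real.rpow_mul_natCast hb.le, unitBallVolume,
    measureReal_def, mul_comm, div_eq_mul_inv, ← Real.rpow_neg hb.le]
  congr 2
  ring

theorem IsPoissonPointProcess.measureReal_count_ne_zero (hX : IsPoissonPointProcess μ l X)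
    {A : Set (EuclideanSpace ℝ (Fin d))} (hA : MeasurableSet A) (hb : Bornology.IsBounded A) :
    μ.real {ω | (X ω ∩ A).Nonempty} = 1 - Real.exp (-(l * volume.real A)) := by
  have h := hX.poisson A hA hb 0
  have hm : MeasurableSet {ω | (X ω ∩ A).encard = (0 : ℕ)} :=
    hX.measurable_count A hA (.of_discrete (s := {((0 : ℕ) : ℕ∞)}))
  have e : {ω | (X ω ∩ A).Nonempty} = {ω | (X ω ∩ A).encard = (0 : ℕ)}ᶜ := by
    ext ω
    simp [nonempty_iff_ne_empty]
  rw [e, probReal_compl_eq_one_sub hm, h]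
  simp

theorem IsPoissonPointProcess.le_measureReal_shotNoise (hX : IsPoissonPointProcess μ l X)
    (hd : 1 ≤ d) (hα : 0 < α) (hb : 0 < b) :
    1 - Real.exp (-(unitBallVolume d / b ^ (d / α) * l)) ≤
      μ.real {ω | ENNReal.ofReal b < shotNoise (powerLaw α) (X ω)} := by
  rw [← volume_real_ball_rpow hd hb, mul_comm,
    ← hX.measureReal_count_ne_zero measurableSet_ball Metric.isBounded_ball]
  refine measureReal_mono ?_
  rintro ω ⟨x, hx, hxb⟩
  rw [mem_ball_zero_iff, ← lt_powerLaw_iff hα hb] at hxb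
  refine hxb.trans_le ?_
  rw [shotNoise, lintegral_pointMeasure _ measurable_powerLaw]
  exact ENNReal.le_tsum (f := fun y : X ω => powerLaw α (y : EuclideanSpace ℝ (Fin d))) ⟨x, hx⟩

theorem IsPoissonPointProcess.measureReal_shotNoise_le (hX : IsPoissonPointProcess μ l X)
    (hd : 1 ≤ d) (hα : (d : ℝ) < α) (hb : 0 < b) :
    μ.real {ω | ENNReal.ofReal b < shotNoise (powerLaw α) (X ω)} ≤
      1 - Real.exp (-(unitBallVolume d / b ^ (d / α) * l)) +
        (∫⁻ x : EuclideanSpace ℝ (Fin d), ∫⁻ y : EuclideanSpace ℝ (Fin d),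
          pairInteraction (powerLaw α) (ENNReal.ofReal b) (x, y)).toReal * l ^ 2 := by
  have hα0 : 0 < α := (Nat.cast_nonneg d).trans_lt hα
  have hI := lintegral_pairInteraction_powerLaw_ne_top hb hd hα
  have h1 := hX.measure_shotNoise_gt_le (measurable_powerLaw (α := α))
    (b := ENNReal.ofReal b) (by simpa) ENNReal.ofReal_ne_top
  have h2 := ENNReal.toReal_mono (ENNReal.mul_ne_top (by simp) hI) h1
  rw [ENNReal.toReal_mul, ENNReal.toReal_pow, ENNReal.coe_toReal, mul_comm] at h2
  rw [← volume_real_ball_rpow hd hb, mul_comm _ (l : ℝ),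
    ← hX.measureReal_count_ne_zero measurableSet_ball Metric.isBounded_ball]
  refine le_trans (measureReal_mono ?_) ((measureReal_union_le _ _).trans
    (add_le_add_right h2 _))
  intro ω hω
  -- An empty ball means that no single summand exceeds `b`, which is the case handled by the pair
  -- interaction.
  by_cases hne : (X ω ∩ Metric.ball 0 (b ^ (-α⁻¹))).Nonempty
  · exact .inl hne
  · refine .inr ⟨fun x hx => not_lt.1 fun hlt => hne ⟨x, hx, ?_⟩, hω⟩
    rwa [mem_ball_zero_iff, ← lt_powerLaw_iff hα0 hb]

end Bounds

theorem mainTheorem3 (d : ℕ) (hd : 1 ≤ d) (α P N u τ : ℝ)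
    (hα : (d : ℝ) < α) (hP : 0 < P) (hN : 0 ≤ N) (hu : 0 < u) (hτ : 0 < τ)
    (hsnr : τ * N < P * u ^ (-α))
    (Ω : ℝ≥0 → Type*) [∀ l, MeasurableSpace (Ω l)] (μ : ∀ l, Measure (Ω l))
    [∀ l, IsProbabilityMeasure (μ l)]
    (X : ∀ l, Ω l → Set (EuclideanSpace ℝ (Fin d)))
    (hX : ∀ l, IsPoissonPointProcess (μ l) l (X l))
    (q : ℝ≥0 → ℝ) (hq : ∀ l, q l = outageProbability (μ l) (X l) α 0 P N u τ) :
    BijOn q univ (Ico (q 0) 1) ∧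
    (fun l : ℝ≥0 => q l - unitBallVolume d * l / (u ^ (-α) / τ - N / P) ^ ((d : ℝ) / α))
      =O[𝓝 0] (fun l : ℝ≥0 => (l : ℝ) ^ 2) ∧
    (fun x : ℝ => transmissionCapacity q x -
        1 / unitBallVolume d * (u ^ (-α) / τ - N / P) ^ ((d : ℝ) / α) * x)
      =O[𝓝[≥] 0] (fun x : ℝ => x ^ 2) := by
  have hd0 : (0 : ℝ) < d := by exact_mod_cast hd
  have hα0 : 0 < α := hd0.trans hα
  have hb : 0 < u ^ (-α) / τ - N / P := by
    rw [sub_pos, div_lt_div_iff₀ hP hτ]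
    linarith
  have hq' : ∀ l, q l = (μ l).real {ω | ENNReal.ofReal (u ^ (-α) / τ - N / P) <
      shotNoise (powerLaw α) (X l ω)} := fun l => by
    rw [hq, outageProbability]
    simp_rw [sinr_lt_iff hP hN hu hτ hb.le]
  -- From here on only the threshold `b > 0` matters.
  generalize u ^ (-α) / τ - N / P = b at hb hq' ⊢
  set c := unitBallVolume d with hc
  have hc0 : 0 < c := by
    refine ENNReal.toReal_pos ?_ Metric.isBounded_closedBall.measure_lt_top.ne
    exact (Metric.measure_closedBall_pos _ _ one_pos).ne'
  set K := (∫⁻ x : EuclideanSpace ℝ (Fin d), ∫⁻ y : EuclideanSpace ℝ (Fin d),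
    pairInteraction (powerLaw α) (ENNReal.ofReal b) (x, y)).toReal with hK
  have hC : 0 < c / b ^ ((d : ℝ) / α) := by positivity
  have hlow : ∀ l : ℝ≥0, 1 - Real.exp (-(c / b ^ ((d : ℝ) / α) * l)) ≤ q l := fun l => by
    rw [hq']; exact (hX l).le_measureReal_shotNoise hd hα0 hb
  have hup : ∀ l : ℝ≥0, q l ≤ 1 - Real.exp (-(c / b ^ ((d : ℝ) / α) * l)) + K * l ^ 2 :=
    fun l => by rw [hq']; exact (hX l).measureReal_shotNoise_le hd hα hb
  have hS := fun l => (hX l).measurable_shotNoise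
    (measurable_powerLaw (α := α) (E := EuclideanSpace ℝ (Fin d)))
  have hν : ∀ l, ((μ l).map fun ω => shotNoise (powerLaw α) (X l ω)).real
      (Ioi (b.toNNReal : ℝ≥0∞)) = q l := fun l => by
    rw [map_measureReal_apply (hS l) measurableSet_Ioi, hq']
    rfl
  have H : IsStableSemigroup (fun l => (μ l).map fun ω => shotNoise (powerLaw α) (X l ω))
      (d / α) b.toNNReal (c / b ^ ((d : ℝ) / α)) K :=
    { isProbabilityMeasure := fun l => Measure.isProbabilityMeasure_map (hS l).aemeasurable
      pos := by positivity
      lt_one := (div_lt_one hα0).2 hα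
      b_ne_zero := by simpa
      C_pos := hC
      conv := map_shotNoise_add hα0 hX
      scale := fun k hk l => map_shotNoise_mul hα0 hX hk l
      lower := fun l => by rw [hν]; exact hlow l
      upper := fun l => by rw [hν]; exact hup l }
  have hbij := H.bijOn_tail
  have h0 := H.tail_zero
  simp only [hν] at hbij h0
  refine ⟨h0.symm ▸ hbij, ?_, ?_⟩
  · refine (isBigO_sub_of_exp_bounds hC ENNReal.toReal_nonneg hlow hup).congr_left fun l => ?_
    ring
  · refine (transmissionCapacity_isBigO hC ENNReal.toReal_nonneg hbij hlow hup).congr_left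
      fun x => ?_
    field_simp
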